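/- Let $n\ge 1$ and $\mathbb H=\{(x,t):x\in\mathbb R^n,\ t>0\}\subset\mathbb R^{n+1}$; write $z=(x,t)$, let $dz=dx\,dt$ be Lebesgue measure and $|E|$ the Lebesgue measure of $E$. Let $\{\Delta_k\}_{k\ge1}$ be a Whitney decomposition of $\mathbb H$, that is, closed cubes with sides parallel to the coordinate axes such that $\bigcup_k\Delta_k=\mathbb H$, the interiors of the $\Delta_k$ are pairwise disjoint, $c\,\mathrm{dist}(\Delta_k,\partial\mathbb H)\le \mathrm{diam}\,\Delta_k\le C\,\mathrm{dist}(\Delta_k,\partial\mathbb H)$ for all $k$ with constants $c,C>0$, and such that the cubes $\Delta_k^*$ with the same centre as $\Delta_k$, enlarged $5/4$ times, are contained in $\mathbb H$ and satisfy $\sum_k\chi_{\Delta_k^*}\le C$ for some constant $C$. Let $\mu$ be a positive Borel measure on $\mathbb H$, let $0<p_i,q_i<\infty$, $i=1,\dots,m$, with $\sum_{i=1}^m 1/q_i=1$, and let $\alpha>-1$. Then the following two conditions are equivalent. (1) There is a constant $C<\infty$ such that for all (real- or complex-valued) functions $f_1,\dots,f_m$ harmonic in $\mathbb H$, $$\int_{\mathbb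 H}\prod_{i=1}^m|f_i(z)|^{p_i}\,d\mu(z)\le C\prod_{i=1}^m\left[\sum_{k=1}^\infty\left(\int_{\Delta_k^*}|f_i(z)|^{p_i}t^\alpha\,dz\right)^{q_i}\right]^{1/q_i},$$ where both sides are elements of $[0,\infty]$ and $0\cdot\infty=0$. (2) There is a constant $C<\infty$ such that $$\mu(\Delta_k)\le C\,|\Delta_k|^{m\left(1+\frac{\alpha}{n+1}\right)}\qquad\text{for all } k\ge1.$$ -/

import Mathlib

open MeasureTheory InnerProductSpace
open scoped ENNReal NNReal

/-- The ambient Euclidean space of points `z = (x, t)`, with `x` the first `n` coordinates and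
`t` the last one. -/
abbrev Amb (n : ℕ) : Type := EuclideanSpace ℝ (Fin (n + 1))

/-- The height `t` of the point `z = (x, t)`. -/
def height {n : ℕ} (z : Amb n) : ℝ := z (Fin.last n)

/-- The open upper half space `{(x, t) : t > 0}`. -/
def upperHalf (n : ℕ) : Set (Amb n) := {z | 0 < height z}

/-- The closed cube with centre `c`, side length `h` and sides parallel to the axes. -/
def closedCube {n : ℕ} (c : Amb n) (h : ℝ) : Set (Amb n) := {z | ∀ i, |z i - c i| ≤ h / 2}

/-- The Euclidean distance between two (nonempty) sets. -/
noncomputable def setDist {n : ℕ} (A B : Set (Amb n)) : ℝ := sInf (Set.image2 dist A B)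

/-- A Whitney decomposition of the upper half space: closed cubes `Δ k` with centre `center k` and
side length `side k`, and their concentric enlargements `Δ* k` by the factor `5/4`. -/
structure WhitneyDecomposition (n : ℕ) where
  center : ℕ → Amb n
  side : ℕ → ℝ
  side_pos : ∀ k, 0 < side k
  /-- the cubes `Δ k` fill the upper half space -/
  iUnion_cube : ⋃ k, closedCube (center k) (side k) = upperHalf n
  /-- the diameter of `Δ k` is comparable to its distance to the boundary of the half space -/
  diam_asymp_dist : ∃ c C : ℝ, 0 < c ∧ 0 < C ∧ ∀ k,
    c * setDist (closedCube (center k) (side k)) (frontier (upperHalf n))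
        ≤ Metric.diam (closedCube (center k) (side k)) ∧
      Metric.diam (closedCube (center k) (side k))
        ≤ C * setDist (closedCube (center k) (side k)) (frontier (upperHalf n))
  /-- distinct cubes have disjoint interiors -/
  disjoint_interior : Pairwise fun j k =>
    Disjoint (interior (closedCube (center j) (side j)))
      (interior (closedCube (center k) (side k)))
  /-- the enlarged cubes `Δ* k` lie in the upper half space -/
  enlarged_subset : ∀ k, closedCube (center k) (5 / 4 * side k) ⊆ upperHalf n
  /-- the enlarged cubes `Δ* k` have bounded overlap -/
  finite_overlap : ∃ C : ℝ≥0, ∀ z : Amb n,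
    ∑' k, (closedCube (center k) (5 / 4 * side k)).indicator (1 : Amb n → ℝ≥0∞) z ≤ C

/-- The cube `Δ k`. -/
def WhitneyDecomposition.cube {n : ℕ} (W : WhitneyDecomposition n) (k : ℕ) : Set (Amb n) :=
  closedCube (W.center k) (W.side k)

/-- The enlarged cube `Δ* k`. -/
def WhitneyDecomposition.enlargedCube {n : ℕ} (W : WhitneyDecomposition n) (k : ℕ) :
    Set (Amb n) :=
  closedCube (W.center k) (5 / 4 * W.side k)

/-! Write `h` for the side of `Δ k`; then `|Δ k| ^ (m(1 + α/(n+1))) = h ^ (m(n+1+α))`, and `t` is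
comparable to `h` on a slightly smaller neighbourhood of `Δ k` than `Δ* k`.

(2) ⇒ (1): for every `p > 0`, `|f|^p` satisfies a sub-mean value inequality, so at each point of `Δ
k` it is at most `C h ^ (-(n+1+α))` times the weighted integral over `Δ* k`
(`exists_enorm_rpow_mul_le`). In the product of `m` such bounds the powers of `h` cancel against
`μ(Δ k)`, and Hölder's inequality for sequences, with `∑ 1/q i = 1`, sums over `k`.

(1) ⇒ (2): insert functions that are at least `1` in modulus on one cube and whose total weighted
integral is `O(h ^ (n+1+α))` (`exists_harmonic_test`). Since `q i ≥ 1`, the `ℓ^q` norms are at most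
`ℓ¹` norms, which bounded overlap reduces to one integral over the half space. The functions are
real parts of Kelvin transforms of a high power of the isotropic form `t + i x₀`, with pole below
the half space at depth comparable to `h`; the high power gives decay fast enough for any `p`.

The mean value property is proved with the weight `w = max 0 (1 - ‖y‖²)`, which avoids surface
integrals. The case `p ≥ 1` follows from `p = 1` by Hölder, and `p ≤ 1` by maximizing `|f|^p` times
a power of the distance to the sphere. -/

/-- The function `u ↦ (max 0 u) ^ 2` is differentiable, with derivative `2 * max 0 u`. -/
theorem hasDerivAt_max_zero_sq (u : ℝ) :
    HasDerivAt (fun u : ℝ => (max 0 u) ^ 2) (2 * max 0 u) u := by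
  rcases lt_trichotomy u 0 with h | h | h
  · rw [max_eq_left h.le, mul_zero]
    refine (hasDerivAt_const u (0 : ℝ)).congr_of_eventuallyEq ?_
    filter_upwards [Iio_mem_nhds h] with v hv
    simp [max_eq_left (le_of_lt (Set.mem_Iio.1 hv))]
  · subst h
    rw [hasDerivAt_iff_isLittleO_nhds_zero]
    have h1 : (fun h : ℝ => (max 0 (0 + h)) ^ 2 - (max (0 : ℝ) 0) ^ 2 - h • (2 * max (0 : ℝ) 0))
        =O[nhds 0] fun h : ℝ => h ^ 2 := by
      refine Asymptotics.IsBigO.of_bound 1 (Filter.Eventually.of_forall fun v => ?_)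
      rcases le_total 0 v with hv | hv
      · simp [max_eq_right hv]
      · simp [max_eq_left hv, sq_nonneg]
    exact h1.trans_isLittleO (by simpa using Asymptotics.isLittleO_pow_id (𝕜 := ℝ) one_lt_two)
  · rw [max_eq_right h.le]
    have := (hasDerivAt_pow 2 u)
    refine (HasDerivAt.congr_of_eventuallyEq (by simpa using this) ?_)
    filter_upwards [Ioi_mem_nhds h] with v hv
    simp [max_eq_right (le_of_lt (Set.mem_Ioi.1 hv))]

/-! ### Weighted mean value property -/

section MeanValue

variable {E F : Type*} [NormedAddCommGroup E]

/-- The weight `y ↦ max 0 (1 - ‖y‖ ^ 2)`, supported in the closed unit ball. -/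
noncomputable def ballWeight (y : E) : ℝ := max 0 (1 - ‖y‖ ^ 2)

theorem continuous_ballWeight : Continuous (ballWeight : E → ℝ) := by
  unfold ballWeight; fun_prop

theorem ballWeight_nonneg (y : E) : 0 ≤ ballWeight y := le_max_left _ _

theorem ballWeight_le_one (y : E) : ballWeight y ≤ 1 :=
  max_le zero_le_one (by nlinarith [norm_nonneg y])

theorem ballWeight_eq_zero {y : E} (hy : 1 ≤ ‖y‖) : ballWeight y = 0 :=
  max_eq_left (by nlinarith)

variable [InnerProductSpace ℝ E] [NormedAddCommGroup F] [NormedSpace ℝ F]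

theorem hasCompactSupport_ballWeight [FiniteDimensional ℝ E] :
    HasCompactSupport (ballWeight : E → ℝ) := by
  have := FiniteDimensional.proper_real E
  refine HasCompactSupport.intro (isCompact_closedBall (0 : E) 1) fun y hy => ?_
  rw [mem_closedBall_zero_iff, not_le] at hy
  exact ballWeight_eq_zero hy.le

/-- Squaring removes the kink of the weight at the unit sphere, and the gradient `-4 w y` lets the
radial derivative `w ∇f · y` be written as `-1/4 ∇(w²) · ∇f`. -/
theorem hasFDerivAt_ballWeight_sq (y : E) :
    HasFDerivAt (fun y : E => ballWeight y ^ 2) ((-4 * ballWeight y) • innerSL ℝ y) y := by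
  have h1 : HasFDerivAt (fun y : E => 1 - ‖y‖ ^ 2) (-(2 • innerSL ℝ y)) y :=
    (hasStrictFDerivAt_norm_sq y).hasFDerivAt.const_sub 1
  have h2 := (hasDerivAt_max_zero_sq (1 - ‖y‖ ^ 2)).comp_hasFDerivAt y h1
  convert! h2 using 1
  ext v
  simp [ballWeight]
  ring

variable [FiniteDimensional ℝ E] [MeasurableSpace E] [BorelSpace E]
  (μ : Measure E) [μ.IsAddHaarMeasure]

theorem integral_ballWeight_pos : 0 < ∫ y, ballWeight y ∂μ := by
  refine continuous_ballWeight.integral_pos_of_hasCompactSupport_nonneg_nonzero (x := 0)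
    hasCompactSupport_ballWeight ballWeight_nonneg ?_
  simp [ballWeight]

/-- The integral is the `r`-derivative of the weighted mean. Integrating `∇(w²) · ∇f` by parts turns
it into a multiple of `∫ w² Δf(x + r y)`, and `w` vanishes wherever `x + r y` might leave the ball
of harmonicity. -/
theorem integral_ballWeight_smul_fderiv_eq_zero {f : E → F} (hf : ContDiff ℝ 2 f) {x : E} {R r : ℝ}
    (hΔ : ∀ z ∈ Metric.ball x R, Laplacian.laplacian f z = 0) (hr : |r| < R) :
    ∫ y, ballWeight y • fderiv ℝ f (x + r • y) y ∂μ = 0 := by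
  set b := stdOrthonormalBasis ℝ E
  have hdf : ContDiff ℝ 1 (fderiv ℝ f) := hf.fderiv_right (by norm_num)
  have hg : ∀ i, ContDiff ℝ 1 (fun y => fderiv ℝ f (x + r • y) (b i)) := fun i => by fun_prop
  have hg' : ∀ i y, fderiv ℝ (fun y => fderiv ℝ f (x + r • y) (b i)) y (b i)
      = r • iteratedFDeriv ℝ 2 f (x + r • y) ![b i, b i] := fun i y => by
    have h1 : HasFDerivAt (fun y => x + r • y) (r • ContinuousLinearMap.id ℝ E) y :=
      ((hasFDerivAt_id y).const_smul r).const_add x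
    have h2 : HasFDerivAt (fderiv ℝ f) (fderiv ℝ (fderiv ℝ f) (x + r • y)) (x + r • y) :=
      (hdf.differentiable (by norm_num) _).hasFDerivAt
    have h3 := (h2.comp y h1).clm_apply (hasFDerivAt_const (b i) y)
    rw [HasFDerivAt.fderiv (f := fun y => fderiv ℝ f (x + r • y) (b i)) h3]
    simp [iteratedFDeriv_two_apply]
  have hw2 : Continuous (fun y : E => ballWeight y ^ 2) := continuous_ballWeight.pow 2
  have hw2c : HasCompactSupport (fun y : E => ballWeight y ^ 2) := by
    simp_rw [pow_two]
    exact hasCompactSupport_ballWeight.mul_left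
  have hdw : ∀ y v : E, fderiv ℝ (fun y : E => ballWeight y ^ 2) y v =
      -4 * ballWeight y * inner ℝ y v := fun y v => by
    rw [(hasFDerivAt_ballWeight_sq y).fderiv]; simp
  have hc1 : ∀ i, Continuous (fun y => fderiv ℝ f (x + r • y) (b i)) := fun i => (hg i).continuous
  have hc2 : ∀ i, Continuous
      (fun y => fderiv ℝ (fun y => fderiv ℝ f (x + r • y) (b i)) y (b i)) := fun i =>
    ((hg i).continuous_fderiv (by norm_num)).clm_apply continuous_const
  have hI1 : ∀ i, Integrable (fun y => fderiv ℝ (fun y : E => ballWeight y ^ 2) y (b i) •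
      fderiv ℝ f (x + r • y) (b i)) μ := fun i => by
    simp_rw [hdw]
    refine Continuous.integrable_of_hasCompactSupport ?_ ?_
    · have := continuous_ballWeight (E := E)
      have := hc1 i
      fun_prop
    · exact ((hasCompactSupport_ballWeight.mul_left (f := fun _ => (-4 : ℝ))).mul_right).smul_right
  have hI2 : ∀ i, Integrable (fun y => ballWeight y ^ 2 •
      fderiv ℝ (fun y => fderiv ℝ f (x + r • y) (b i)) y (b i)) μ := fun i =>
    Continuous.integrable_of_hasCompactSupport (hw2.smul (hc2 i)) hw2c.smul_right
  have hibp : ∀ i, ∫ y, fderiv ℝ (fun y : E => ballWeight y ^ 2) y (b i) •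
      fderiv ℝ f (x + r • y) (b i) ∂μ =
      -∫ y, ballWeight y ^ 2 • fderiv ℝ (fun y => fderiv ℝ f (x + r • y) (b i)) y (b i) ∂μ :=
    fun i => by
      rw [integral_smul_fderiv_eq_neg_fderiv_smul_of_integrable (hI1 i) (hI2 i)
        (Continuous.integrable_of_hasCompactSupport (hw2.smul (hc1 i)) hw2c.smul_right)
        (fun y _ => (hasFDerivAt_ballWeight_sq y).differentiableAt)
        (fun y _ => (hg i).differentiable (by norm_num) y), neg_neg]
  have hsum1 : ∫ y, (-4 : ℝ) • ballWeight y • fderiv ℝ f (x + r • y) y ∂μ =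
      ∑ i, ∫ y, fderiv ℝ (fun y : E => ballWeight y ^ 2) y (b i) •
        fderiv ℝ f (x + r • y) (b i) ∂μ := by
    rw [← integral_finsetSum _ fun i _ => hI1 i]
    refine integral_congr_ae (Filter.Eventually.of_forall fun y => ?_)
    simp only [hdw]
    have hy : fderiv ℝ f (x + r • y) y = fderiv ℝ f (x + r • y) (∑ i, b.repr y i • b i) := by
      rw [b.sum_repr]
    rw [hy, map_sum, Finset.smul_sum, Finset.smul_sum]
    refine Finset.sum_congr rfl fun i _ => ?_
    rw [map_smul, b.repr_apply_apply, real_inner_comm, smul_smul, smul_smul, mul_assoc]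
  have hsum2 : ∑ i, ∫ y, ballWeight y ^ 2 •
      fderiv ℝ (fun y => fderiv ℝ f (x + r • y) (b i)) y (b i) ∂μ = 0 := by
    rw [← integral_finsetSum _ fun i _ => hI2 i]
    refine integral_eq_zero_of_ae (Filter.Eventually.of_forall fun y => ?_)
    simp only [hg', ← Finset.smul_sum, Pi.zero_apply]
    rcases le_or_gt 1 ‖y‖ with hy | hy
    · simp [ballWeight_eq_zero hy]
    · have hz := hΔ (x + r • y) (by
        rw [mem_ball_iff_norm, add_sub_cancel_left, norm_smul, Real.norm_eq_abs]
        nlinarith [abs_nonneg r])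
      rw [laplacian_eq_iteratedFDeriv_orthonormalBasis f b] at hz
      have hz' : ∑ i, iteratedFDeriv ℝ 2 f (x + r • y) ![b i, b i] = 0 := hz
      rw [hz', smul_zero, smul_zero]
  rw [Finset.sum_congr rfl fun i _ => hibp i, Finset.sum_neg_distrib, hsum2, neg_zero,
    integral_smul, smul_eq_zero] at hsum1
  exact hsum1.resolve_left (by norm_num)

/-- The weighted mean value property of harmonic functions. -/
theorem integral_ballWeight_smul_eq [CompleteSpace F] {f : E → F} (hf : ContDiff ℝ 2 f) {x : E}
    {R r : ℝ} (hΔ : ∀ z ∈ Metric.ball x R, Laplacian.laplacian f z = 0) (hr : |r| < R) :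
    ∫ y, ballWeight y • f (x + r • y) ∂μ = (∫ y, ballWeight y ∂μ) • f x := by
  have hcf : Continuous f := hf.continuous
  have hcdf : Continuous (fderiv ℝ f) := hf.continuous_fderiv (by norm_num)
  have hcw := continuous_ballWeight (E := E)
  have := FiniteDimensional.proper_real E
  have key : ∀ s : ℝ, |s| < R →
      HasDerivAt (fun s => ∫ y, ballWeight y • f (x + s • y) ∂μ) 0 s := by
    intro s hs
    obtain ⟨M, hM⟩ := (isCompact_closedBall x (|s| + 1)).exists_bound_of_continuousOn
      hcdf.continuousOn
    have hM0 : 0 ≤ M := (norm_nonneg _).trans (hM x (by simp; positivity))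
    have h := hasDerivAt_integral_of_dominated_loc_of_deriv_le (μ := μ) (x₀ := s)
      (F := fun s y => ballWeight y • f (x + s • y))
      (F' := fun s y => ballWeight y • fderiv ℝ f (x + s • y) y)
      (bound := fun y => M * ballWeight y) (s := Metric.ball s 1)
      (Metric.ball_mem_nhds s one_pos) ?_ ?_ ?_ ?_ ?_ ?_
    · rw [← integral_ballWeight_smul_fderiv_eq_zero μ hf hΔ hs]
      exact h.2
    · exact Filter.Eventually.of_forall fun t =>
        Continuous.aestronglyMeasurable (by fun_prop)
    · exact Continuous.integrable_of_hasCompactSupport (by fun_prop)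
        hasCompactSupport_ballWeight.smul_right
    · exact Continuous.aestronglyMeasurable (by fun_prop)
    · refine Filter.Eventually.of_forall fun y t ht => ?_
      rw [norm_smul, Real.norm_of_nonneg (ballWeight_nonneg y), mul_comm]
      rcases le_or_gt 1 ‖y‖ with hy | hy
      · simp [ballWeight_eq_zero hy]
      refine mul_le_mul_of_nonneg_right ?_ (ballWeight_nonneg y)
      have ht' : |t| ≤ |s| + 1 := by
        rw [Metric.mem_ball, Real.dist_eq] at ht
        have := abs_add_le s (t - s)
        rw [add_sub_cancel] at this
        linarith
      have := hM (x + t • y) (by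
        rw [mem_closedBall_iff_norm, add_sub_cancel_left, norm_smul, Real.norm_eq_abs]
        nlinarith [abs_nonneg t, norm_nonneg y])
      calc ‖fderiv ℝ f (x + t • y) y‖ ≤ ‖fderiv ℝ f (x + t • y)‖ * ‖y‖ :=
            ContinuousLinearMap.le_opNorm _ _
        _ ≤ M * 1 := by gcongr
        _ = M := mul_one M
    · exact (hcw.integrable_of_hasCompactSupport hasCompactSupport_ballWeight).const_mul M
    · refine Filter.Eventually.of_forall fun y t ht => ?_
      have h1 : HasDerivAt (fun t : ℝ => x + t • y) y t := by
        simpa using ((hasDerivAt_id t).smul_const y).const_add x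
      exact (((hf.differentiable (by norm_num)) _).hasFDerivAt.comp_hasDerivAt t h1).const_smul _
  have hR : 0 < R := (abs_nonneg r).trans_lt hr
  have hconst := Metric.isOpen_ball.is_const_of_deriv_eq_zero (𝕜 := ℝ) (x := r) (y := 0)
    (f := fun s => ∫ y, ballWeight y • f (x + s • y) ∂μ) (s := Metric.ball (0 : ℝ) R)
    (convex_ball 0 R).isPreconnected
    (fun s hs => (key s (by simpa using hs)).differentiableAt.differentiableWithinAt)
    (fun s hs => (key s (by simpa using hs)).deriv) (by simpa using hr)
    (Metric.mem_ball_self hR)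
  simp only [zero_smul, add_zero] at hconst
  rw [hconst, integral_smul_const]

end MeanValue

/-! ### Sub-mean value inequalities for all positive exponents -/

section LocalEstimates

variable {E F : Type*} [NormedAddCommGroup E] [InnerProductSpace ℝ E] [FiniteDimensional ℝ E]
  [NormedAddCommGroup F] [NormedSpace ℝ F]

open Module

/-- A function harmonic on a ball agrees on a smaller ball with a globally `C²` function. -/
theorem exists_contDiff_eqOn_ball {f : E → F} {x : E} {R r : ℝ} (hr : 0 < r) (hrR : r < R)
    (hf : HarmonicOnNhd f (Metric.ball x R)) :
    ∃ g : E → F, ContDiff ℝ 2 g ∧ Set.EqOn g f (Metric.ball x r) ∧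
      ∀ z ∈ Metric.ball x r, Laplacian.laplacian g z = 0 := by
  let χ : ContDiffBump x := ⟨r, (r + R) / 2, hr, by linarith⟩
  have hχ : ∀ z ∈ Metric.ball x r, (fun z => χ z • f z) =ᶠ[nhds z] f := fun z hz => by
    filter_upwards [χ.eventuallyEq_one_of_mem_ball hz] with y hy
    simp [hy]
  refine ⟨fun z => χ z • f z, ?_, fun z hz => (hχ z hz).self_of_nhds, fun z hz => ?_⟩
  · rw [contDiff_iff_contDiffAt]
    intro z
    by_cases hz : z ∈ Metric.ball x R
    · exact χ.contDiff.contDiffAt.smul (hf z hz).1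
    · have hz' : z ∉ tsupport χ := by
        rw [χ.tsupport_eq]
        simp only [Metric.mem_closedBall, Metric.mem_ball, χ] at hz ⊢
        linarith
      refine (contDiffAt_const (c := (0 : F))).congr_of_eventuallyEq ?_
      filter_upwards [notMem_tsupport_iff_eventuallyEq.1 hz'] with y hy
      simp [hy]
  · rw [(laplacian_congr_nhds (hχ z hz)).self_of_nhds]
    exact (hf z (Metric.ball_subset_ball hrR.le hz)).2.self_of_nhds

variable [MeasurableSpace E] [BorelSpace E] (μ : Measure E) [μ.IsAddHaarMeasure]

/-- Affine change of variables for the Lebesgue integral. -/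
theorem ofReal_pow_mul_lintegral_comp_add_smul (g : E → ℝ≥0∞) (x : E) {r : ℝ} (hr : 0 < r) :
    ENNReal.ofReal (r ^ finrank ℝ E) * ∫⁻ y, g (x + r • y) ∂μ = ∫⁻ z, g z ∂μ := by
  have h1 : ∫⁻ y, g (x + r • y) ∂μ = ∫⁻ z, g (x + z) ∂(Measure.map (r • ·) μ) :=
    ((Homeomorph.smulOfNeZero r hr.ne').toMeasurableEquiv.measurableEmbedding.lintegral_map
      (fun z => g (x + z))).symm
  have hpos : 0 < r ^ finrank ℝ E := by positivity
  rw [h1, Measure.map_addHaar_smul μ hr.ne', lintegral_smul_measure, lintegral_add_left_eq_self,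
    abs_of_pos (inv_pos.2 hpos), smul_eq_mul, ← mul_assoc, ← ENNReal.ofReal_mul hpos.le,
    mul_inv_cancel₀ hpos.ne', ENNReal.ofReal_one, one_mul]

/-- The `L¹` bound for harmonic functions at the centre of a ball. -/
theorem exists_enorm_mul_le_lintegral_ball [CompleteSpace F] :
    ∃ C : ℝ≥0, ∀ (f : E → F) (x : E) (R : ℝ), 0 < R → HarmonicOnNhd f (Metric.ball x R) →
      ‖f x‖ₑ * ENNReal.ofReal (R ^ finrank ℝ E) ≤ C * ∫⁻ z in Metric.ball x R, ‖f z‖ₑ ∂μ := by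
  set I := ∫ y : E, ballWeight y ∂μ with hI
  have hIpos : 0 < I := integral_ballWeight_pos μ
  refine ⟨(2 ^ finrank ℝ E / I).toNNReal, fun f x R hR hf => ?_⟩
  -- The mean is taken at radius `R/2`, strictly inside the radius `2R/3` where `g` agrees with `f`.
  obtain ⟨g, hg, hgf, hΔ⟩ := exists_contDiff_eqOn_ball (r := 2 * R / 3) (by positivity)
    (by linarith) hf
  have hr2 : 0 < R / 2 := by positivity
  have hmv := integral_ballWeight_smul_eq μ hg hΔ (r := R / 2)
    (by rw [abs_of_pos hr2]; linarith)
  have hx : g x = f x := hgf (Metric.mem_ball_self (by positivity))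
  have h1 : ‖f x‖ₑ * ENNReal.ofReal I ≤
      ∫⁻ y, (Metric.ball x R).indicator (fun z => ‖f z‖ₑ) (x + (R / 2) • y) ∂μ := by
    calc ‖f x‖ₑ * ENNReal.ofReal I = ‖I • g x‖ₑ := by
          rw [enorm_smul, hx, Real.enorm_of_nonneg hIpos.le, mul_comm]
      _ ≤ ∫⁻ y, ‖ballWeight y • g (x + (R / 2) • y)‖ₑ ∂μ := by
          rw [← hmv]; exact enorm_integral_le_lintegral_enorm _
      _ ≤ _ := by
          refine lintegral_mono fun y => ?_
          rw [enorm_smul]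
          rcases le_or_gt 1 ‖y‖ with hy | hy
          · simp [ballWeight_eq_zero hy]
          · have hd : dist (x + (R / 2) • y) x ≤ R / 2 := by
              rw [dist_eq_norm, add_sub_cancel_left, norm_smul, Real.norm_of_nonneg hr2.le]
              nlinarith
            rw [Set.indicator_of_mem (Metric.mem_ball.2 (by linarith)),
              hgf (Metric.mem_ball.2 (by linarith)), Real.enorm_of_nonneg (ballWeight_nonneg y)]
            refine mul_le_of_le_one_left' ?_
            rw [← ENNReal.ofReal_one]
            exact ENNReal.ofReal_le_ofReal (ballWeight_le_one y)
  have h2 := ofReal_pow_mul_lintegral_comp_add_smul μ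
    ((Metric.ball x R).indicator (fun z => ‖f z‖ₑ)) x hr2
  rw [lintegral_indicator measurableSet_ball] at h2
  rw [← h2]
  have h3 : ENNReal.ofReal (R ^ finrank ℝ E) =
      ENNReal.ofReal (2 ^ finrank ℝ E / I) * ENNReal.ofReal ((R / 2) ^ finrank ℝ E)
        * ENNReal.ofReal I := by
    rw [← ENNReal.ofReal_mul (by positivity), ← ENNReal.ofReal_mul (by positivity)]
    congr 1
    rw [div_pow]
    field_simp
  calc ‖f x‖ₑ * ENNReal.ofReal (R ^ finrank ℝ E)
      = ENNReal.ofReal (2 ^ finrank ℝ E / I) * (ENNReal.ofReal ((R / 2) ^ finrank ℝ E) *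
        (‖f x‖ₑ * ENNReal.ofReal I)) := by rw [h3]; ring
    _ ≤ _ := by
      rw [ENNReal.ofReal]
      gcongr

/-- The `Lᵖ` bound for harmonic functions at the centre of a ball, for `1 ≤ p`. -/
theorem exists_enorm_rpow_mul_le_lintegral_ball_of_one_le [CompleteSpace F] {p : ℝ} (hp : 1 ≤ p) :
    ∃ C : ℝ≥0, ∀ (f : E → F) (x : E) (R : ℝ), 0 < R → HarmonicOnNhd f (Metric.ball x R) →
      ‖f x‖ₑ ^ p * ENNReal.ofReal (R ^ finrank ℝ E) ≤
        C * ∫⁻ z in Metric.ball x R, ‖f z‖ₑ ^ p ∂μ := by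
  have hp0 : 0 < p := by linarith
  obtain ⟨C, hC⟩ := exists_enorm_mul_le_lintegral_ball (F := F) μ
  have hκ : μ (Metric.ball (0 : E) 1) ≠ ∞ := measure_ball_lt_top.ne
  refine ⟨C ^ p * (μ (Metric.ball (0 : E) 1)).toNNReal ^ (p - 1), fun f x R hR hf => ?_⟩
  set T := ENNReal.ofReal (R ^ finrank ℝ E)
  have hT0 : T ≠ 0 := by
    simp only [T, ne_eq, ENNReal.ofReal_eq_zero, not_le]; positivity
  have hTt : T ≠ ∞ := ENNReal.ofReal_ne_top
  have hmeas : AEStronglyMeasurable f (μ.restrict (Metric.ball x R)) :=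
    hf.continuousOn.aestronglyMeasurable measurableSet_ball
  -- Hölder on the ball, of volume `κ T`. After raising to the power `p`, the factor `T ^ (p - 1)`
  -- cancels and leaves one `T`.
  have hH := eLpNorm'_le_eLpNorm'_mul_rpow_measure_univ zero_lt_one hp hmeas
  rw [eLpNorm'_eq_lintegral_enorm, eLpNorm'_eq_lintegral_enorm, Measure.restrict_apply_univ,
    Measure.addHaar_ball_of_pos μ x hR] at hH
  simp only [ENNReal.rpow_one, one_div, inv_one] at hH
  have h1 := ENNReal.rpow_le_rpow ((hC f x R hR hf).trans (mul_le_mul_right hH _)) hp0.le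
  set J := ∫⁻ z in Metric.ball x R, ‖f z‖ₑ ^ p ∂μ
  set κ := μ (Metric.ball (0 : E) 1)
  have e1 : (1 - p⁻¹) * p = p - 1 := by field_simp
  rw [ENNReal.mul_rpow_of_nonneg _ _ hp0.le, ENNReal.mul_rpow_of_nonneg _ _ hp0.le,
    ENNReal.mul_rpow_of_nonneg _ _ hp0.le, ← ENNReal.rpow_mul, ← ENNReal.rpow_mul,
    inv_mul_cancel₀ hp0.ne', ENNReal.rpow_one, e1, ENNReal.mul_rpow_of_nonneg _ _ (by linarith)]
    at h1
  have h2 : T ^ p = T * T ^ (p - 1) := by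
    nth_rewrite 2 [← ENNReal.rpow_one T]
    rw [← ENNReal.rpow_add _ _ hT0 hTt]; congr 1; ring
  rw [ENNReal.coe_mul, ENNReal.coe_rpow_of_nonneg _ hp0.le,
    ENNReal.coe_rpow_of_nonneg _ (by linarith), ENNReal.coe_toNNReal hκ]
  have hs0 : T ^ (p - 1) ≠ 0 := (ENNReal.rpow_pos (pos_iff_ne_zero.2 hT0) hTt).ne'
  have hst : T ^ (p - 1) ≠ ∞ := ENNReal.rpow_ne_top_of_nonneg (by linarith) hTt
  rw [← ENNReal.mul_le_mul_iff_left hs0 hst]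
  calc ‖f x‖ₑ ^ p * T * T ^ (p - 1) = ‖f x‖ₑ ^ p * T ^ p := by rw [h2, mul_assoc]
    _ ≤ _ := h1
    _ = _ := by ring

/-- The `Lᵖ` bound for harmonic functions at the centre of a ball, for `p ≤ 1`. -/
theorem exists_enorm_rpow_mul_le_lintegral_ball_of_le_one [CompleteSpace F] {p : ℝ} (hp0 : 0 < p)
    (hp : p ≤ 1) :
    ∃ C : ℝ≥0, ∀ (f : E → F) (x : E) (R : ℝ), 0 < R → HarmonicOnNhd f (Metric.ball x R) →
      ‖f x‖ₑ ^ p * ENNReal.ofReal (R ^ finrank ℝ E) ≤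
        C * ∫⁻ z in Metric.ball x R, ‖f z‖ₑ ^ p ∂μ := by
  obtain ⟨C, hC⟩ := exists_enorm_mul_le_lintegral_ball (F := F) μ
  have := FiniteDimensional.proper_real E
  set d := finrank ℝ E with hd
  set K : ℝ≥0 := (2 ^ d : ℝ≥0) ^ ((1 - p) / p) with hK
  refine ⟨2 ^ d * (2 ^ d * (C * K)), fun f x R hR hf => ?_⟩
  set J := ∫⁻ z in Metric.ball x R, ‖f z‖ₑ ^ p ∂μ
  set ρ := R / 2 with hρ
  have hρ0 : 0 < ρ := by positivity
  have hsub : Metric.closedBall x ρ ⊆ Metric.ball x R :=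
    Metric.closedBall_subset_ball (by linarith)
  have hcf : ContinuousOn f (Metric.closedBall x ρ) := hf.continuousOn.mono hsub
  -- Maximality gives `|f|^p ≤ 2^d |f z₀|^p` on the ball about `z₀` of half its distance to the
  -- sphere. There `|f| = |f|^p |f|^(1-p) ≤ K |f|^p |f z₀|^(1-p)`, and `|f z₀|^(1-p)` can be divided
  -- out of the `L¹` bound.
  obtain ⟨z₀, hz₀, hmax⟩ := (isCompact_closedBall x ρ).exists_isMaxOn
    (Metric.nonempty_closedBall.2 hρ0.le)
    (f := fun z => ‖f z‖ ^ p * (ρ - dist z x) ^ d)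
    ((hcf.norm.rpow_const fun _ _ => Or.inr hp0.le).mul (by fun_prop))
  have hx := hmax (Metric.mem_closedBall_self hρ0.le)
  simp only [Set.mem_ofPred_eq, dist_self, sub_zero] at hx
  rw [Metric.mem_closedBall] at hz₀
  have hconv : ∀ z, ENNReal.ofReal (‖f z‖ ^ p) = ‖f z‖ₑ ^ p := fun z => by
    rw [← ofReal_norm, ENNReal.ofReal_rpow_of_nonneg (norm_nonneg _) hp0.le]
  suffices h : ENNReal.ofReal (‖f z₀‖ ^ p * (ρ - dist z₀ x) ^ d) ≤ 2 ^ d * (C * K) * J by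
    calc ‖f x‖ₑ ^ p * ENNReal.ofReal (R ^ d) = 2 ^ d * ENNReal.ofReal (‖f x‖ ^ p * ρ ^ d) := by
          rw [← hconv, ← ENNReal.ofReal_mul (by positivity),
            show (2 : ℝ≥0∞) ^ d = ENNReal.ofReal (2 ^ d) by
              rw [ENNReal.ofReal_pow zero_le_two, ENNReal.ofReal_ofNat],
            ← ENNReal.ofReal_mul (by positivity)]
          congr 1
          rw [hρ, div_pow]; field_simp
      _ ≤ 2 ^ d * (2 ^ d * (C * K) * J) := by
          gcongr
          exact (ENNReal.ofReal_le_ofReal hx).trans h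
      _ = _ := by push_cast; ring
  rcases eq_or_ne (f z₀) 0 with h0 | h0
  · simp [h0, Real.zero_rpow hp0.ne']
  rcases hz₀.eq_or_lt with he | hlt
  -- In dimension zero the weight has exponent `0` and does not vanish on the sphere, but then `z₀ =
  -- x` is not on it.
  · by_cases hd0 : d = 0
    · have : Subsingleton E := finrank_zero_iff.1 (hd ▸ hd0)
      rw [Subsingleton.elim z₀ x, dist_self] at he
      exact absurd he hρ0.ne
    · simp [he, hd0]
  set s := (ρ - dist z₀ x) / 2 with hs
  have hs0 : 0 < s := by rw [hs]; linarith
  have hball : Metric.ball z₀ s ⊆ Metric.closedBall x ρ := fun z hz => by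
    rw [Metric.mem_ball] at hz
    rw [Metric.mem_closedBall]
    linarith [dist_triangle z z₀ x]
  have hbd : ∀ z ∈ Metric.ball z₀ s, ‖f z‖ₑ ≤ ‖f z‖ₑ ^ p * (K * ‖f z₀‖ₑ ^ (1 - p)) := by
    intro z hz
    have h1 := hmax (hball hz)
    simp only [Set.mem_ofPred_eq] at h1
    have h2 : s ≤ ρ - dist z x := by
      rw [Metric.mem_ball] at hz
      linarith [dist_triangle z z₀ x]
    have h3 : ‖f z‖ ^ p ≤ 2 ^ d * ‖f z₀‖ ^ p := by
      have h4 : ‖f z‖ ^ p * s ^ d ≤ ‖f z₀‖ ^ p * (2 * s) ^ d := by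
        refine le_trans ?_ (h1.trans_eq ?_)
        · gcongr
        · rw [hs]; congr 2; ring
      rw [mul_pow, ← mul_assoc] at h4
      rw [mul_comm (2 ^ d : ℝ)]
      exact le_of_mul_le_mul_right h4 (by positivity)
    have h5 : ‖f z‖ₑ ^ p ≤ 2 ^ d * ‖f z₀‖ₑ ^ p := by
      rw [← hconv, ← hconv, show (2 : ℝ≥0∞) ^ d = ENNReal.ofReal (2 ^ d) by
              rw [ENNReal.ofReal_pow zero_le_two, ENNReal.ofReal_ofNat],
            ← ENNReal.ofReal_mul (by positivity)]
      exact ENNReal.ofReal_le_ofReal h3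
    have h6 := ENNReal.rpow_le_rpow h5 (z := (1 - p) / p) (div_nonneg (by linarith) hp0.le)
    rw [ENNReal.mul_rpow_of_nonneg _ _ (div_nonneg (by linarith) hp0.le), ← ENNReal.rpow_mul,
      ← ENNReal.rpow_mul, mul_div_cancel₀ _ hp0.ne'] at h6
    calc ‖f z‖ₑ = ‖f z‖ₑ ^ p * ‖f z‖ₑ ^ (1 - p) := by
          rw [← ENNReal.rpow_add_of_nonneg _ _ hp0.le (by linarith), add_sub_cancel,
            ENNReal.rpow_one]
      _ ≤ _ := by
          gcongr
          rw [hK, ENNReal.coe_rpow_of_nonneg _ (div_nonneg (by linarith) hp0.le)]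
          exact_mod_cast h6
  have h1 := hC f z₀ s hs0 fun z hz => hf z (hsub (hball hz))
  have h2 : ∫⁻ z in Metric.ball z₀ s, ‖f z‖ₑ ∂μ ≤ J * (K * ‖f z₀‖ₑ ^ (1 - p)) := by
    have hfin : (K : ℝ≥0∞) * ‖f z₀‖ₑ ^ (1 - p) ≠ ∞ :=
      ENNReal.mul_ne_top ENNReal.coe_ne_top
        (ENNReal.rpow_ne_top_of_nonneg (by linarith) enorm_ne_top)
    calc ∫⁻ z in Metric.ball z₀ s, ‖f z‖ₑ ∂μ
        ≤ ∫⁻ z in Metric.ball z₀ s, ‖f z‖ₑ ^ p * (K * ‖f z₀‖ₑ ^ (1 - p)) ∂μ :=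
          setLIntegral_mono' measurableSet_ball hbd
      _ = (∫⁻ z in Metric.ball z₀ s, ‖f z‖ₑ ^ p ∂μ) * (K * ‖f z₀‖ₑ ^ (1 - p)) :=
          lintegral_mul_const' _ _ hfin
      _ ≤ _ := by
          gcongr
          exact lintegral_mono_set (hball.trans hsub)
  have h3 := h1.trans (mul_le_mul_right h2 _)
  have hn0 : ‖f z₀‖ₑ ^ (1 - p) ≠ 0 :=
    (ENNReal.rpow_pos (pos_iff_ne_zero.2 (by simpa using h0)) enorm_ne_top).ne'
  have hnt : ‖f z₀‖ₑ ^ (1 - p) ≠ ∞ := ENNReal.rpow_ne_top_of_nonneg (by linarith) enorm_ne_top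
  have h4 : ‖f z₀‖ₑ ^ p * ENNReal.ofReal (s ^ d) ≤ C * K * J := by
    rw [← ENNReal.mul_le_mul_iff_left hn0 hnt]
    calc ‖f z₀‖ₑ ^ p * ENNReal.ofReal (s ^ d) * ‖f z₀‖ₑ ^ (1 - p)
        = ‖f z₀‖ₑ * ENNReal.ofReal (s ^ d) := by
          rw [mul_right_comm, ← ENNReal.rpow_add_of_nonneg _ _ hp0.le (by linarith),
            add_sub_cancel, ENNReal.rpow_one]
      _ ≤ _ := h3
      _ = _ := by ring
  calc ENNReal.ofReal (‖f z₀‖ ^ p * (ρ - dist z₀ x) ^ d)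
      = 2 ^ d * (‖f z₀‖ₑ ^ p * ENNReal.ofReal (s ^ d)) := by
        rw [← hconv, show (2 : ℝ≥0∞) ^ d = ENNReal.ofReal (2 ^ d) by
              rw [ENNReal.ofReal_pow zero_le_two, ENNReal.ofReal_ofNat],
            ← ENNReal.ofReal_mul (by positivity), ← ENNReal.ofReal_mul (by positivity)]
        congr 1
        rw [show ρ - dist z₀ x = 2 * s by rw [hs]; ring, mul_pow]; ring
    _ ≤ 2 ^ d * (C * K * J) := by gcongr
    _ = _ := by ring

/-- The `Lᵖ` bound for harmonic functions at the centre of a ball, for all `0 < p < ∞`. -/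
theorem exists_enorm_rpow_mul_le_lintegral_ball [CompleteSpace F] {p : ℝ} (hp : 0 < p) :
    ∃ C : ℝ≥0, ∀ (f : E → F) (x : E) (R : ℝ), 0 < R → HarmonicOnNhd f (Metric.ball x R) →
      ‖f x‖ₑ ^ p * ENNReal.ofReal (R ^ finrank ℝ E) ≤
        C * ∫⁻ z in Metric.ball x R, ‖f z‖ₑ ^ p ∂μ :=
  (le_total 1 p).elim (exists_enorm_rpow_mul_le_lintegral_ball_of_one_le μ)
    (exists_enorm_rpow_mul_le_lintegral_ball_of_le_one μ hp)

end LocalEstimates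

/-! ### Cubes and the boundary of the half space -/

section Geometry

variable {n : ℕ}

@[fun_prop]
theorem continuous_height : Continuous (height : Amb n → ℝ) := by
  unfold height; fun_prop

theorem isOpen_upperHalf : IsOpen (upperHalf n) :=
  isOpen_lt continuous_const continuous_height

theorem isClosed_closedCube (c : Amb n) (h : ℝ) : IsClosed (closedCube c h) := by
  have : closedCube c h = ⋂ i, {z : Amb n | |z i - c i| ≤ h / 2} := by
    ext z; simp [closedCube]
  rw [this]
  exact isClosed_iInter fun i => isClosed_le (by fun_prop) continuous_const

theorem volume_closedCube (c : Amb n) {h : ℝ} (hh : 0 ≤ h) :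
    volume (closedCube c h) = ENNReal.ofReal h ^ (n + 1) := by
  have h1 : closedCube c h = (@WithLp.ofLp 2 (Fin (n + 1) → ℝ)) ⁻¹'
      Metric.closedBall (WithLp.ofLp c) (h / 2) := by
    ext z
    simp [closedCube, dist_pi_le_iff (by linarith : 0 ≤ h / 2), Real.dist_eq]
  rw [h1, (PiLp.volume_preserving_ofLp _).measure_preimage
    measurableSet_closedBall.nullMeasurableSet, Real.volume_pi_closedBall _ (by linarith),
    mul_div_cancel₀ _ (two_ne_zero), Fintype.card_fin, ENNReal.ofReal_pow hh]

theorem dist_le_of_mem_closedCube {c z w : Amb n} {h : ℝ} (hz : z ∈ closedCube c h)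
    (hw : w ∈ closedCube c h) : dist z w ≤ √((n : ℝ) + 1) * h := by
  have hh : 0 ≤ h := by linarith [(abs_nonneg _).trans (hz 0)]
  rw [EuclideanSpace.dist_eq, ← Real.sqrt_sq hh, ← Real.sqrt_mul (by positivity)]
  refine Real.sqrt_le_sqrt ?_
  calc ∑ i, dist (z i) (w i) ^ 2 ≤ ∑ _i : Fin (n + 1), h ^ 2 := by
        refine Finset.sum_le_sum fun i _ => ?_
        gcongr
        rw [Real.dist_eq]
        have h1 := abs_le.1 (hz i)
        have h2 := abs_le.1 (hw i)
        rw [abs_le]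
        constructor <;> linarith
    _ = _ := by simp

theorem abs_coord_sub_le_dist (z w : Amb n) (i : Fin (n + 1)) : |z i - w i| ≤ dist z w := by
  rw [dist_eq_norm, ← Real.norm_eq_abs]
  exact PiLp.norm_apply_le (z - w) i

theorem height_eq_zero_of_mem_frontier {z : Amb n} (hz : z ∈ frontier (upperHalf n)) :
    height z = 0 :=
  (frontier_lt_subset_eq continuous_const continuous_height hz).symm

theorem frontier_upperHalf_nonempty : (frontier (upperHalf n)).Nonempty := by
  refine nonempty_frontier_iff.2 ⟨⟨WithLp.toLp 2 fun _ => 1, ?_⟩, fun h => ?_⟩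
  · simp [upperHalf, height]
  · have : (0 : Amb n) ∈ upperHalf n := h ▸ Set.mem_univ _
    simp [upperHalf, height] at this

theorem sub_half_le_setDist {c : Amb n} {h : ℝ} (hh : 0 ≤ h) :
    height c - h / 2 ≤ setDist (closedCube c h) (frontier (upperHalf n)) := by
  refine le_csInf (Set.Nonempty.image2 ⟨c, fun i => by simp; linarith⟩
    frontier_upperHalf_nonempty) ?_
  rintro _ ⟨z, hz, w, hw, rfl⟩
  have h1 := abs_le.1 (hz (Fin.last n))
  have h2 := abs_le.1 (abs_coord_sub_le_dist z w (Fin.last n))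
  have h3 := height_eq_zero_of_mem_frontier hw
  unfold height at *
  linarith

end Geometry

/-! ### Estimates on Whitney cubes; sufficiency of the measure condition -/

namespace WhitneyDecomposition

variable {n : ℕ} (W : WhitneyDecomposition n)

/-- The centre of the bottom face of `Δ* k` still lies in the open half space. -/
theorem lt_height_center (k : ℕ) : 5 / 8 * W.side k < height (W.center k) := by
  have hk := W.side_pos k
  have h : W.center k - EuclideanSpace.single (Fin.last n) (5 / 8 * W.side k) ∈ upperHalf n := by
    refine W.enlarged_subset k fun i => ?_
    by_cases hi : i = Fin.last n
    · simp only [hi, PiLp.sub_apply, PiLp.single_apply, if_true, sub_sub_cancel_left,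
        abs_neg, abs_of_pos (by positivity : 0 < 5 / 8 * W.side k)]
      linarith
    · simp only [PiLp.sub_apply, PiLp.single_apply, hi, if_false, sub_zero, sub_self,
        abs_zero]
      positivity
  simp only [upperHalf, height, Set.mem_ofPred_eq, PiLp.sub_apply, PiLp.single_apply,
    if_true] at h
  unfold height
  linarith

theorem exists_height_center_le : ∃ K : ℝ, 0 < K ∧ ∀ k, height (W.center k) ≤ K * W.side k := by
  obtain ⟨c, _, hc, -, h⟩ := W.diam_asymp_dist
  refine ⟨√((n : ℝ) + 1) / c + 1 / 2, by positivity, fun k => ?_⟩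
  have hk := W.side_pos k
  have h1 := sub_half_le_setDist (c := W.center k) hk.le
  have h2 : Metric.diam (closedCube (W.center k) (W.side k)) ≤ √((n : ℝ) + 1) * W.side k :=
    Metric.diam_le_of_forall_dist_le (by positivity) fun z hz w hw =>
      dist_le_of_mem_closedCube hz hw
  have h3 := ((mul_le_mul_of_nonneg_left h1 hc.le).trans (h k).1).trans h2
  have h4 : height (W.center k) - W.side k / 2 ≤ √((n : ℝ) + 1) * W.side k / c := by
    rw [le_div_iff₀ hc]; linarith
  have h5 : √((n : ℝ) + 1) * W.side k / c = √((n : ℝ) + 1) / c * W.side k := by ring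
  linarith

theorem volume_cube_rpow (m : ℕ) (α : ℝ) (k : ℕ) :
    volume (W.cube k) ^ ((m : ℝ) * (1 + α / ((n : ℝ) + 1))) =
      ENNReal.ofReal (W.side k ^ ((n : ℝ) + 1 + α)) ^ m := by
  have hk := W.side_pos k
  rw [cube, volume_closedCube _ hk.le, ← ENNReal.rpow_natCast, ← ENNReal.rpow_natCast,
    ← ENNReal.rpow_mul, ← ENNReal.ofReal_rpow_of_pos hk, ← ENNReal.rpow_mul]
  congr 1
  push_cast
  field_simp

theorem _root_.exists_rpow_lower_bound {a b : ℝ} (ha : 0 < a) (α : ℝ) :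
    ∃ κ : ℝ, 0 < κ ∧ ∀ h t : ℝ, 0 < h → a * h ≤ t → t ≤ b * h → κ * h ^ α ≤ t ^ α := by
  rcases le_total 0 α with hα | hα
  · refine ⟨a ^ α, by positivity, fun h t hh h1 _ => ?_⟩
    rw [← Real.mul_rpow ha.le hh.le]
    exact Real.rpow_le_rpow (by positivity) h1 hα
  -- The maximum keeps the base positive with no assumption on `b`.
  · refine ⟨(max a b) ^ α, by positivity, fun h t hh h1 h2 => ?_⟩
    have : 0 < a * h := by positivity
    rw [← Real.mul_rpow (by positivity) hh.le]
    refine Real.rpow_le_rpow_of_nonpos (by linarith) (h2.trans ?_) hα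
    gcongr
    exact le_max_right _ _

/-- The values of a harmonic function on a Whitney cube are controlled by the weighted integral over
the enlarged cube. -/
theorem exists_enorm_rpow_mul_le {F : Type*} [NormedAddCommGroup F] [NormedSpace ℝ F]
    [CompleteSpace F] {p : ℝ} (hp : 0 < p) (α : ℝ) :
    ∃ C : ℝ≥0, ∀ f : Amb n → F, HarmonicOnNhd f (upperHalf n) → ∀ k, ∀ z ∈ W.cube k,
      ‖f z‖ₑ ^ p * ENNReal.ofReal (W.side k ^ ((n : ℝ) + 1 + α)) ≤
        C * ∫⁻ z in W.enlargedCube k, ‖f z‖ₑ ^ p * ENNReal.ofReal (height z ^ α) := by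
  obtain ⟨C, hC⟩ := exists_enorm_rpow_mul_le_lintegral_ball (F := F) (volume : Measure (Amb n)) hp
  obtain ⟨K, hK, hKs⟩ := W.exists_height_center_le
  -- A ball of radius `h/16` about a point of `Δ k` stays within `h/2 + h/16 < 5h/8` of the centre
  -- in each coordinate, so it lies in `Δ* k` at height at least `5h/8 - 9h/16 = h/16`.
  obtain ⟨κ, hκ, hκh⟩ := exists_rpow_lower_bound (a := 1 / 16) (b := K + 1) (by norm_num) α
  refine ⟨C * (16 ^ (n + 1) / κ).toNNReal, fun f hf k z hz => ?_⟩
  set h := W.side k with hh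
  have hpos : 0 < h := W.side_pos k
  have hfin : Module.finrank ℝ (Amb n) = n + 1 := finrank_euclideanSpace_fin
  have hcoord : ∀ w ∈ Metric.ball z (h / 16), ∀ i, |w i - W.center k i| ≤ h / 2 + h / 16 := by
    intro w hw i
    have h1 := abs_coord_sub_le_dist w z i
    have h2 := hz i
    rw [Metric.mem_ball] at hw
    calc |w i - W.center k i| = |(z i - W.center k i) + (w i - z i)| := by ring_nf
      _ ≤ _ := abs_add_le _ _
      _ ≤ _ := by linarith
  have hsub : Metric.ball z (h / 16) ⊆ W.enlargedCube k := fun w hw i =>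
    (hcoord w hw i).trans (by rw [← hh]; linarith)
  have hheight : ∀ w ∈ Metric.ball z (h / 16), κ * h ^ α ≤ height w ^ α := by
    intro w hw
    have h1 := abs_le.1 (hcoord w hw (Fin.last n))
    have h2 := W.lt_height_center k
    have h3 := hKs k
    rw [← hh] at h2 h3
    unfold height at *
    exact hκh h _ hpos (by linarith) (by linarith)
  have h1 := hC f z (h / 16) (by positivity) fun w hw => hf w (W.enlarged_subset k (hsub hw))
  rw [hfin] at h1
  have e1 : ENNReal.ofReal (h ^ ((n : ℝ) + 1 + α)) = ENNReal.ofReal ((h / 16) ^ (n + 1)) *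
      (ENNReal.ofReal (16 ^ (n + 1) / κ) * ENNReal.ofReal (κ * h ^ α)) := by
    rw [← ENNReal.ofReal_mul (by positivity), ← ENNReal.ofReal_mul (by positivity)]
    congr 1
    rw [Real.rpow_add hpos, show (n : ℝ) + 1 = ((n + 1 : ℕ) : ℝ) by push_cast; rfl,
      Real.rpow_natCast, div_pow]
    field_simp
  calc ‖f z‖ₑ ^ p * ENNReal.ofReal (h ^ ((n : ℝ) + 1 + α))
      = ‖f z‖ₑ ^ p * ENNReal.ofReal ((h / 16) ^ (n + 1)) *
        (ENNReal.ofReal (16 ^ (n + 1) / κ) * ENNReal.ofReal (κ * h ^ α)) := by rw [e1, mul_assoc]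
    _ ≤ C * (∫⁻ w in Metric.ball z (h / 16), ‖f w‖ₑ ^ p) *
        (ENNReal.ofReal (16 ^ (n + 1) / κ) * ENNReal.ofReal (κ * h ^ α)) := by gcongr
    _ = C * ENNReal.ofReal (16 ^ (n + 1) / κ) *
        ∫⁻ w in Metric.ball z (h / 16), ‖f w‖ₑ ^ p * ENNReal.ofReal (κ * h ^ α) := by
      rw [lintegral_mul_const' _ _ ENNReal.ofReal_ne_top]; ring
    _ ≤ C * ENNReal.ofReal (16 ^ (n + 1) / κ) *
        ∫⁻ w in Metric.ball z (h / 16), ‖f w‖ₑ ^ p * ENNReal.ofReal (height w ^ α) := by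
      refine mul_le_mul_right (setLIntegral_mono' measurableSet_ball fun w hw => ?_) _
      gcongr
      exact hheight w hw
    _ ≤ _ := by
      rw [ENNReal.coe_mul, ENNReal.ofReal]
      gcongr

/-- Hölder's inequality for a finite product of sequences. -/
theorem _root_.tsum_prod_le_prod_tsum_rpow {m : ℕ} (A : Fin m → ℕ → ℝ≥0∞) {q : Fin m → ℝ}
    (hq : ∀ i, 0 < q i) (hsum : ∑ i, 1 / q i = 1) :
    ∑' k, ∏ i, A i k ≤ ∏ i, (∑' k, A i k ^ q i) ^ (1 / q i) := by
  have h := ENNReal.lintegral_prod_norm_pow_le (μ := Measure.count) (Finset.univ : Finset (Fin m))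
    (f := fun i (k : ℕ) => A i k ^ q i) (p := fun i => 1 / q i)
    (fun i _ => (measurable_of_countable _).aemeasurable) hsum
    (fun i _ => (one_div_pos.2 (hq i)).le)
  simp only [lintegral_count, ← ENNReal.rpow_mul, mul_one_div_cancel (hq _).ne',
    ENNReal.rpow_one] at h
  exact h

theorem lintegral_prod_le_of_measure_cube_le {𝕜 : Type*} [RCLike 𝕜] {m : ℕ}
    (μ : Measure (Amb n)) {p q : Fin m → ℝ} (hp : ∀ i, 0 < p i) (hq : ∀ i, 0 < q i)
    (hsum : ∑ i, 1 / q i = 1) (α : ℝ)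
    (hμ : ∃ C : ℝ≥0, ∀ k, μ (W.cube k) ≤
      C * volume (W.cube k) ^ ((m : ℝ) * (1 + α / ((n : ℝ) + 1)))) :
    ∃ C : ℝ≥0, ∀ f : Fin m → Amb n → 𝕜, (∀ i, HarmonicOnNhd (f i) (upperHalf n)) →
      ∫⁻ z in upperHalf n, ∏ i, ‖f i z‖ₑ ^ p i ∂μ ≤
        C * ∏ i, (∑' k, (∫⁻ z in W.enlargedCube k,
          ‖f i z‖ₑ ^ p i * ENNReal.ofReal (height z ^ α)) ^ q i) ^ (1 / q i) := by
  obtain ⟨C, hC⟩ := hμ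
  choose D hD using fun i => W.exists_enorm_rpow_mul_le (F := 𝕜) (hp i) α
  refine ⟨C * ∏ i, D i, fun f hf => ?_⟩
  set A : Fin m → ℕ → ℝ≥0∞ := fun i k => ∫⁻ z in W.enlargedCube k,
          ‖f i z‖ₑ ^ p i * ENNReal.ofReal (height z ^ α) with hA
  have hcube : ∀ k, ∫⁻ z in W.cube k, ∏ i, ‖f i z‖ₑ ^ p i ∂μ ≤
      (C * ∏ i, (D i : ℝ≥0∞)) * ∏ i, A i k := by
    intro k
    set V := ENNReal.ofReal (W.side k ^ ((n : ℝ) + 1 + α)) with hV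
    have hV0 : V ≠ 0 := by
      have := W.side_pos k
      simp only [hV, ne_eq, ENNReal.ofReal_eq_zero, not_le]; positivity
    have hVt : V ≠ ∞ := ENNReal.ofReal_ne_top
    calc ∫⁻ z in W.cube k, ∏ i, ‖f i z‖ₑ ^ p i ∂μ
        ≤ ∫⁻ z in W.cube k, ∏ i, (D i * A i k * V⁻¹) ∂μ := by
          refine setLIntegral_mono' (isClosed_closedCube _ _).measurableSet fun z hz => ?_
          refine Finset.prod_le_prod' fun i _ => ?_
          rw [← div_eq_mul_inv, ENNReal.le_div_iff_mul_le (Or.inl hV0) (Or.inl hVt)]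
          exact hD i (f i) (hf i) k z hz
      _ = (∏ i, (D i * A i k * V⁻¹)) * μ (W.cube k) := setLIntegral_const _ _
      _ ≤ (∏ i, (D i * A i k * V⁻¹)) * (C * V ^ m) := by
          gcongr
          rw [hV, ← W.volume_cube_rpow]
          exact hC k
      _ = (C * ∏ i, (D i : ℝ≥0∞)) * (∏ i, A i k) * (V⁻¹ * V) ^ m := by
          rw [Finset.prod_mul_distrib, Finset.prod_mul_distrib, Finset.prod_const,
            Finset.card_univ, Fintype.card_fin, mul_pow]
          ring
      _ = _ := by rw [ENNReal.inv_mul_cancel hV0 hVt, one_pow, mul_one]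
  calc ∫⁻ z in upperHalf n, ∏ i, ‖f i z‖ₑ ^ p i ∂μ
      ≤ ∑' k, ∫⁻ z in W.cube k, ∏ i, ‖f i z‖ₑ ^ p i ∂μ := by
        rw [← W.iUnion_cube]
        exact lintegral_iUnion_le _ _
    _ ≤ ∑' k, (C * ∏ i, (D i : ℝ≥0∞)) * ∏ i, A i k := ENNReal.tsum_le_tsum hcube
    _ = (C * ∏ i, (D i : ℝ≥0∞)) * ∑' k, ∏ i, A i k := ENNReal.tsum_mul_left
    _ ≤ (C * ∏ i, (D i : ℝ≥0∞)) * ∏ i, (∑' k, A i k ^ q i) ^ (1 / q i) := by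
        gcongr
        exact tsum_prod_le_prod_tsum_rpow A hq hsum
    _ = _ := by
        push_cast
        rfl

end WhitneyDecomposition

/-! ### Kelvin transforms of powers of linear forms -/

section Kernel

variable {E : Type*} [NormedAddCommGroup E] [InnerProductSpace ℝ E]

/-- The Kelvin transform of the power `ζ ^ N` of a linear form, with exponent `b` of `‖·‖ ^ 2` and
pole `a`. -/
noncomputable def kelvinPow (ζ : E →L[ℝ] ℂ) (N : ℕ) (b : ℝ) (a : E) (y : E) : ℂ :=
  (‖y - a‖ ^ 2) ^ b • ζ (y - a) ^ N

theorem hasFDerivAt_norm_sub_sq_rpow (b : ℝ) {a y : E} (hy : y ≠ a) :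
    HasFDerivAt (fun y : E => (‖y - a‖ ^ 2) ^ b)
      ((2 * b * (‖y - a‖ ^ 2) ^ (b - 1)) • innerSL ℝ (y - a)) y := by
  have h0 : ‖y - a‖ ^ 2 ≠ 0 := pow_ne_zero _ (norm_ne_zero_iff.2 (sub_ne_zero.2 hy))
  have h1 : HasFDerivAt (fun y : E => ‖y - a‖ ^ 2) (2 • innerSL ℝ (y - a)) y := by
    have := (hasStrictFDerivAt_norm_sq (y - a)).hasFDerivAt.comp y ((hasFDerivAt_id y).sub_const a)
    exact this
  convert! h1.rpow_const (p := b) (Or.inl h0) using 1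
  ext v
  simp
  ring

theorem hasFDerivAt_clm_sub_pow (ζ : E →L[ℝ] ℂ) (N : ℕ) (a y : E) :
    HasFDerivAt (fun y : E => ζ (y - a) ^ (N + 1)) (((N + 1 : ℂ) * ζ (y - a) ^ N) • ζ) y := by
  have h1 : HasFDerivAt (fun y : E => ζ (y - a)) ζ y :=
    ζ.hasFDerivAt.comp y ((hasFDerivAt_id y).sub_const a)
  convert! h1.pow (N + 1) using 1
  ext v
  simp

theorem contDiffAt_kelvinPow (ζ : E →L[ℝ] ℂ) (N : ℕ) (b : ℝ) {a y : E} (hy : y ≠ a) :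
    ContDiffAt ℝ 2 (kelvinPow ζ N b a) y := by
  have h0 : ‖y - a‖ ^ 2 ≠ 0 := pow_ne_zero _ (norm_ne_zero_iff.2 (sub_ne_zero.2 hy))
  have h1 : ContDiffAt ℝ 2 (fun y : E => ‖y - a‖ ^ 2) y :=
    (contDiffAt_id.sub contDiffAt_const).norm_sq ℝ
  have h2 : ContDiffAt ℝ 2 (fun y : E => ζ (y - a) ^ N) y :=
    (ζ.contDiff.contDiffAt.comp y (contDiffAt_id.sub contDiffAt_const)).pow N
  exact (h1.rpow_const_of_ne h0).smul h2

theorem fderiv_kelvinPow_apply (ζ : E →L[ℝ] ℂ) (N : ℕ) (b : ℝ) {a y : E} (hy : y ≠ a) (e : E) :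
    fderiv ℝ (kelvinPow ζ (N + 1) b a) y e =
      (2 * b * inner ℝ (y - a) e) • ((‖y - a‖ ^ 2) ^ (b - 1) • ζ (y - a) ^ (N + 1)) +
        ((N + 1 : ℂ) * ζ e) * ((‖y - a‖ ^ 2) ^ b • ζ (y - a) ^ N) := by
  have h := (hasFDerivAt_norm_sub_sq_rpow b hy).smul (hasFDerivAt_clm_sub_pow ζ N a y)
  rw [HasFDerivAt.fderiv (f := kelvinPow ζ (N + 1) b a) h]
  simp only [add_apply, smul_apply,
    ContinuousLinearMap.smulRight_apply, innerSL_apply_apply, smul_eq_mul, Complex.real_smul]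
  push_cast
  ring

/-- Every term is kept as a multiple of some `kelvinPow`, so that the sum over a basis collapses.
The power `N + 2` avoids truncated subtraction in the two derivatives. -/
theorem iteratedFDeriv_two_kelvinPow (ζ : E →L[ℝ] ℂ) (N : ℕ) (b : ℝ) {a y : E} (hy : y ≠ a)
    (e : E) (he : inner ℝ e e = (1 : ℝ)) :
    iteratedFDeriv ℝ 2 (kelvinPow ζ (N + 2) b a) y ![e, e] =
      (2 * b : ℝ) • kelvinPow ζ (N + 2) (b - 1) a y +
      (4 * b * (b - 1) * inner ℝ (y - a) e ^ 2 : ℝ) • kelvinPow ζ (N + 2) (b - 1 - 1) a y +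
      ((4 * b * (N + 2) : ℝ) * (inner ℝ (y - a) e • ζ e)) * kelvinPow ζ (N + 1) (b - 1) a y +
      ((N + 2) * (N + 1) * ζ e ^ 2) * kelvinPow ζ N b a y := by
  have hd : ∀ (M : ℕ) (c : ℝ), HasFDerivAt (kelvinPow ζ M c a) (fderiv ℝ (kelvinPow ζ M c a) y) y :=
    fun M c => ((contDiffAt_kelvinPow ζ M c hy).differentiableAt (by norm_num)).hasFDerivAt
  have hev : (fun y => fderiv ℝ (kelvinPow ζ (N + 2) b a) y e) =ᶠ[nhds y] fun y =>
      (2 * b * inner ℝ (y - a) e) • kelvinPow ζ (N + 2) (b - 1) a y +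
        (((N + 1 : ℕ) + 1 : ℂ) * ζ e) * kelvinPow ζ (N + 1) b a y := by
    filter_upwards [isOpen_ne.mem_nhds hy] with z hz
    exact fderiv_kelvinPow_apply ζ (N + 1) b hz e
  have hin : HasFDerivAt (fun y : E => 2 * b * inner ℝ (y - a) e) ((2 * b) • innerSL ℝ e) y := by
    have h1 : HasFDerivAt (fun y : E => innerSL ℝ e (y - a)) (innerSL ℝ e) y :=
      (innerSL ℝ e).hasFDerivAt.comp y ((hasFDerivAt_id y).sub_const a)
    refine (h1.const_mul (2 * b)).congr_of_eventuallyEq (Filter.Eventually.of_forall fun z => ?_)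
    simp [real_inner_comm]
  have h2 : fderiv ℝ (fderiv ℝ (kelvinPow ζ (N + 2) b a)) y e e =
      fderiv ℝ (fun y => fderiv ℝ (kelvinPow ζ (N + 2) b a) y e) y e := by
    have hdd : DifferentiableAt ℝ (fderiv ℝ (kelvinPow ζ (N + 2) b a)) y :=
      ((contDiffAt_kelvinPow ζ (N + 2) b hy).fderiv_right (m := 1)
        (by norm_num)).differentiableAt (by norm_num)
    rw [(hdd.hasFDerivAt.clm_apply (hasFDerivAt_const e y)).fderiv]
    simp
  have h3 := (hin.smul (hd (N + 2) (b - 1))).add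
    ((hd (N + 1) b).const_mul (((N + 1 : ℕ) + 1 : ℂ) * ζ e))
  rw [iteratedFDeriv_two_apply]
  simp only [Matrix.cons_val_zero, Matrix.cons_val_one]
  rw [h2, hev.fderiv_eq, HasFDerivAt.fderiv (f := fun y =>
      (2 * b * inner ℝ (y - a) e) • kelvinPow ζ (N + 2) (b - 1) a y +
        (((N + 1 : ℕ) + 1 : ℂ) * ζ e) * kelvinPow ζ (N + 1) b a y) h3]
  simp only [add_apply, smul_apply,
    ContinuousLinearMap.smulRight_apply, fderiv_kelvinPow_apply ζ _ _ hy, innerSL_apply_apply, he]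
  simp only [kelvinPow, Complex.real_smul, smul_eq_mul]
  push_cast
  ring

variable [FiniteDimensional ℝ E]

/-- The Kelvin transform of a power of an isotropic linear form is harmonic away from its pole. -/
theorem laplacian_kelvinPow {ι : Type*} [Fintype ι] (v : OrthonormalBasis ι ℝ E)
    (ζ : E →L[ℝ] ℂ) (hζ : ∑ i, ζ (v i) ^ 2 = 0) (N : ℕ) {b : ℝ}
    (hb : b = 1 - (N + 2) - Fintype.card ι / 2) {a y : E} (hy : y ≠ a) :
    Laplacian.laplacian (kelvinPow ζ (N + 2) b a) y = 0 := by
  rw [laplacian_eq_iteratedFDeriv_orthonormalBasis _ v]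
  simp only
  rw [Finset.sum_congr rfl fun i _ => iteratedFDeriv_two_kelvinPow ζ N b hy (v i)
    (by rw [real_inner_self_eq_norm_sq, v.norm_eq_one]; norm_num)]
  simp only [Finset.sum_add_distrib, ← Finset.sum_mul, ← Finset.mul_sum, ← Finset.sum_smul, hζ]
  have h1 : ∑ i, inner ℝ (y - a) (v i) ^ 2 = ‖y - a‖ ^ 2 := by
    have := v.sum_sq_norm_inner_left (y - a)
    simpa using this
  have h2 : ∑ i, inner ℝ (y - a) (v i) • ζ (v i) = ζ (y - a) := by
    conv_rhs => rw [← v.sum_repr' (y - a), map_sum]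
    exact Finset.sum_congr rfl fun i _ => by rw [map_smul, real_inner_comm]
  have hpos : 0 < ‖y - a‖ ^ 2 := by
    have := norm_pos_iff.2 (sub_ne_zero.2 hy)
    positivity
  have h3 : (‖y - a‖ ^ 2) * (‖y - a‖ ^ 2) ^ (b - 1 - 1) = (‖y - a‖ ^ 2) ^ (b - 1) := by
    rw [Real.rpow_sub_one hpos.ne' (b - 1), mul_div_cancel₀ _ hpos.ne']
  rw [h1, h2]
  have h4 : (‖y - a‖ ^ 2) • kelvinPow ζ (N + 2) (b - 1 - 1) a y =
      kelvinPow ζ (N + 2) (b - 1) a y := by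
    rw [kelvinPow, smul_smul, h3, kelvinPow]
  have h5 : ζ (y - a) * kelvinPow ζ (N + 1) (b - 1) a y = kelvinPow ζ (N + 2) (b - 1) a y := by
    simp only [kelvinPow, Complex.real_smul]; ring
  rw [mul_smul (4 * b * (b - 1)), h4,
    mul_assoc ((4 * b * (N + 2) : ℝ) : ℂ), h5]
  simp only [Finset.sum_const, Finset.card_univ, ← Complex.coe_smul, smul_eq_mul, mul_zero, zero_mul,
    add_zero, nsmul_eq_mul]
  -- With `d` the dimension, the coefficient is `2b(d + 2(b - 1) + 2(N + 2))`, which the choice of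
  -- `b` makes zero.
  rw [← add_mul, ← add_mul]
  refine mul_eq_zero_of_left ?_ _
  rw [hb]
  push_cast
  ring

end Kernel

/-! ### Harmonic functions concentrated near a cube -/

section TestFunctions

variable {n : ℕ}

/-- The isotropic linear form `z ↦ t + i x₀`. -/
noncomputable def isotropicForm (n : ℕ) : Amb n →L[ℝ] ℂ :=
  Complex.ofRealCLM.comp (EuclideanSpace.proj (Fin.last n)) +
    Complex.I • Complex.ofRealCLM.comp (EuclideanSpace.proj 0)

theorem isotropicForm_apply (z : Amb n) :
    isotropicForm n z = (z (Fin.last n) : ℂ) + Complex.I * (z 0 : ℂ) := by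
  simp [isotropicForm]

/-- The nonzero terms are `1` and `i² = -1`; `n ≥ 1` makes the two coordinates distinct. -/
theorem sum_isotropicForm_sq (hn : 1 ≤ n) :
    ∑ i, isotropicForm n (EuclideanSpace.basisFun (Fin (n + 1)) ℝ i) ^ 2 = 0 := by
  have h0 : (0 : Fin (n + 1)) ≠ Fin.last n := by
    rw [Ne, Fin.ext_iff]; simp; omega
  rw [Finset.sum_eq_add_of_mem (Fin.last n) 0 (Finset.mem_univ _) (Finset.mem_univ _) h0.symm]
  · simp [isotropicForm_apply, h0, h0.symm]
  · intro i _ hi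
    simp [isotropicForm_apply, hi.1.symm, hi.2.symm]

theorem norm_isotropicForm_le (hn : 1 ≤ n) (z : Amb n) : ‖isotropicForm n z‖ ≤ ‖z‖ := by
  have h0 : (0 : Fin (n + 1)) ≠ Fin.last n := by
    rw [Ne, Fin.ext_iff]; simp; omega
  rw [← sq_le_sq₀ (norm_nonneg _) (norm_nonneg _), EuclideanSpace.real_norm_sq_eq,
    isotropicForm_apply, Complex.sq_norm, Complex.normSq_apply]
  calc _ = ∑ i ∈ {Fin.last n, 0}, z i ^ 2 := by
        rw [Finset.sum_pair h0.symm]; simp; ring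
    _ ≤ _ := Finset.sum_le_univ_sum_of_nonneg fun i => sq_nonneg _

/-- The test function is a real part, so the argument of `t + i x₀` seen from the pole must be small
on the cube for a lower bound to hold. -/
theorem exists_half_le_re_pow (N : ℕ) :
    ∃ δ : ℝ, 0 < δ ∧ ∀ y : ℝ, |y| < δ → 1 / 2 ≤ ((1 + Complex.I * y : ℂ) ^ N).re := by
  have hc : Continuous fun y : ℝ => ((1 + Complex.I * y : ℂ) ^ N).re := by fun_prop
  have h := (hc.tendsto 0).eventually (lt_mem_nhds (a := 1 / 2) (by simp; norm_num))
  obtain ⟨δ, hδ, h⟩ := Metric.eventually_nhds_iff.1 h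
  exact ⟨δ, hδ, fun y hy => (h (by simpa using hy)).le⟩

/-- Harmonic functions in the half space which are bounded below on a given cube and decay rapidly
away from it, uniformly in the cube. -/
theorem exists_harmonic_decay (𝕜 : Type*) [RCLike 𝕜] (hn : 1 ≤ n) {K Q : ℝ} (hK : 0 < K)
    (hQ : 0 < Q) :
    ∃ A : ℝ, 0 < A ∧ ∀ (c : Amb n) (h : ℝ), 0 < h → 0 < height c → height c ≤ K * h →
      ∃ f : Amb n → 𝕜, HarmonicOnNhd f (upperHalf n) ∧
        (∀ z ∈ closedCube c h, 0 < height z → 1 ≤ ‖f z‖) ∧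
        ∀ y : Amb n, 0 < height y →
          ‖f (c - EuclideanSpace.single (Fin.last n) (height c) + h • y)‖ ≤
            A * ∏ i, (1 + |y i|) ^ (-Q) := by
  obtain ⟨N, hN⟩ := exists_nat_ge (Q * (n + 1))
  obtain ⟨δ, hδ, hre⟩ := exists_half_le_re_pow (N + 2)
  have h0 : (0 : Fin (n + 1)) ≠ Fin.last n := by
    rw [Ne, Fin.ext_iff]; simp; omega
  -- The pole will lie at depth `s h` below the boundary; `1/s < δ` makes `|x₀ - c₀| / (t + s h) <
  -- δ` on the cube.
  set s : ℝ := 1 + 1 / δ with hs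
  have hs1 : 1 ≤ s := by rw [hs]; linarith [one_div_pos.2 hδ]
  have hsδ : 1 / s < δ := by
    rw [div_lt_iff₀ (by linarith), hs, mul_add, mul_one_div_cancel hδ.ne']; linarith
  set b : ℝ := 1 - (N + 2) - (n + 1) / 2 with hb
  have hb0 : b ≤ 0 := by
    rw [hb]
    linarith [(Nat.cast_nonneg N : (0 : ℝ) ≤ N), (Nat.cast_nonneg n : (0 : ℝ) ≤ n)]
  -- The kernel is homogeneous of degree `-M` about its pole, and `M ≥ Q(n + 1)` provides decay `Q`
  -- in each coordinate.
  set M : ℝ := N + n + 1 with hM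
  have hMb : ((N + 2 : ℕ) : ℝ) + 2 * b = -M := by rw [hM, hb]; push_cast; ring
  -- On the cube `‖z - a‖ ≤ L h`: the three terms bound the cube's diameter, the height of its
  -- centre and the depth of the pole.
  set L : ℝ := √((n : ℝ) + 1) + K + s with hL
  have hL0 : 0 < L := by positivity
  set c₁ : ℝ := s ^ (N + 2) / 2 * (L ^ 2) ^ b with hc₁
  have hc₁0 : 0 < c₁ := by positivity
  refine ⟨2 ^ M / c₁, by positivity, fun c h hh hc hcK => ?_⟩
  set a : Amb n := c - EuclideanSpace.single (Fin.last n) (height c + s * h) with ha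
  have halast : ∀ z : Amb n, (z - a) (Fin.last n) = height z + s * h := fun z => by
    simp [ha, height]
  have haother : ∀ (z : Amb n) (i : Fin (n + 1)), i ≠ Fin.last n → (z - a) i = z i - c i :=
    fun z i hi => by simp [ha, hi]
  have hne : ∀ z ∈ upperHalf n, z ≠ a := by
    rintro z hz rfl
    have h1 := halast a
    have : 0 < height a := hz
    have : 0 < s * h := by positivity
    simp at h1
    linarith
  -- Taking real parts serves real and complex scalars alike.
  set T : ℂ →L[ℝ] 𝕜 := (RCLike.ofRealCLM (K := 𝕜)).comp Complex.reCLM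
  set g := kelvinPow (isotropicForm n) (N + 2) b a with hg
  have hgre : ∀ z, (g z).re = (‖z - a‖ ^ 2) ^ b * (isotropicForm n (z - a) ^ (N + 2)).re := by
    intro z
    rw [hg, kelvinPow, Complex.smul_re, smul_eq_mul]
  have hT : ∀ z, ‖((c₁⁻¹ * h ^ M) • (T ∘ g)) z‖ = c₁⁻¹ * h ^ M * |(g z).re| := by
    intro z
    rw [Pi.smul_apply, norm_smul, Real.norm_of_nonneg (by positivity)]
    simp [T]
  refine ⟨(c₁⁻¹ * h ^ M) • (T ∘ g), ?_, ?_, ?_⟩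
  · refine HarmonicOnNhd.const_smul (HarmonicOnNhd.comp_CLM (fun z hz => ⟨?_, ?_⟩) T)
    · exact contDiffAt_kelvinPow _ _ _ (hne z hz)
    · filter_upwards [isOpen_upperHalf.mem_nhds hz] with w hw
      exact laplacian_kelvinPow (EuclideanSpace.basisFun (Fin (n + 1)) ℝ) _
        (sum_isotropicForm_sq hn) N (by rw [hb]; simp) (hne w hw)
  · intro z hz hz0
    have hw1 : s * h ≤ height z + s * h := by linarith
    have hsh : 0 < s * h := by positivity
    have hy : |(z 0 - c 0) / (height z + s * h)| < δ := by
      rw [abs_div, abs_of_pos (by linarith : 0 < height z + s * h)]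
      refine lt_of_le_of_lt ?_ hsδ
      rw [div_le_div_iff₀ (by linarith) (by linarith)]
      have := hz 0
      nlinarith
    have hζ : isotropicForm n (z - a) = ((height z + s * h : ℝ) : ℂ) *
        (1 + Complex.I * (((z 0 - c 0) / (height z + s * h) : ℝ) : ℂ)) := by
      rw [isotropicForm_apply, halast, haother z 0 h0]
      have : ((height z + s * h : ℝ) : ℂ) ≠ 0 := by
        exact_mod_cast (by linarith : 0 < height z + s * h).ne'
      push_cast at this ⊢
      field_simp
    have hζre : (s * h) ^ (N + 2) / 2 ≤ (isotropicForm n (z - a) ^ (N + 2)).re := by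
      rw [hζ, mul_pow ((height z + s * h : ℝ) : ℂ), ← Complex.ofReal_pow, Complex.re_ofReal_mul]
      calc (s * h) ^ (N + 2) / 2 = (s * h) ^ (N + 2) * (1 / 2) := by ring
        _ ≤ _ := by
          gcongr
          exact hre _ hy
    have hnorm : ‖z - a‖ ≤ L * h := by
      have e1 : z - a = (z - c) + EuclideanSpace.single (Fin.last n) (height c + s * h) := by
        rw [ha]; abel
      have e2 : dist z c ≤ √((n : ℝ) + 1) * h :=
        dist_le_of_mem_closedCube hz fun i => by simp; positivity
      rw [dist_eq_norm] at e2
      rw [e1]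
      refine (norm_add_le _ _).trans ?_
      rw [PiLp.norm_single, Real.norm_of_nonneg (by positivity), hL]
      nlinarith
    have hpos : 0 < ‖z - a‖ := norm_pos_iff.2 (sub_ne_zero.2 (hne z hz0))
    have hρ : (L ^ 2) ^ b * h ^ (2 * b) ≤ (‖z - a‖ ^ 2) ^ b := by
      have e1 : (L ^ 2) ^ b * h ^ (2 * b) = ((L * h) ^ 2) ^ b := by
        rw [mul_pow, Real.mul_rpow (by positivity) (by positivity), Real.rpow_mul hh.le,
          Real.rpow_two]
      rw [e1]
      exact Real.rpow_le_rpow_of_nonpos (by positivity) (by gcongr) hb0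
    have hlow : c₁ * h ^ (-M) ≤ (g z).re := by
      rw [hgre, ← hMb, Real.rpow_add hh, Real.rpow_natCast]
      calc c₁ * (h ^ (N + 2) * h ^ (2 * b))
          = ((L ^ 2) ^ b * h ^ (2 * b)) * ((s * h) ^ (N + 2) / 2) := by
            rw [hc₁, mul_pow]; ring
        _ ≤ _ := by gcongr
    rw [hT]
    calc 1 = c₁⁻¹ * h ^ M * (c₁ * h ^ (-M)) := by
          rw [Real.rpow_neg hh.le]
          have : 0 < h ^ M := by positivity
          field_simp
      _ ≤ _ := by
          gcongr
          exact hlow.trans (le_abs_self _)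
  · intro y hy
    set z := c - EuclideanSpace.single (Fin.last n) (height c) + h • y with hz
    have hzlast : (z - a) (Fin.last n) = h * (height y + s) := by
      rw [halast]; simp [hz, height]; ring
    have hzother : ∀ i, i ≠ Fin.last n → (z - a) i = h * y i := fun i hi => by
      rw [haother z i hi]; simp [hz, hi]
    have hle : ∀ i, |(z - a) i| ≤ ‖z - a‖ := fun i => by
      rw [← Real.norm_eq_abs]; exact PiLp.norm_apply_le (z - a) i
    have hlast : h * (1 + |y (Fin.last n)|) ≤ ‖z - a‖ := by
      refine le_trans ?_ (hle (Fin.last n))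
      have hy' : 0 < y (Fin.last n) := hy
      rw [hzlast, abs_of_pos hy', abs_of_pos (by positivity)]
      rw [show height y = y (Fin.last n) from rfl]
      refine mul_le_mul_of_nonneg_left ?_ hh.le
      linarith
    have hh1 : h ≤ ‖z - a‖ := by
      refine le_trans ?_ hlast
      nlinarith [abs_nonneg (y (Fin.last n))]
    have hpos : 0 < ‖z - a‖ := hh.trans_le hh1
    -- Both `1` and every `|y i|` are at most `‖z - a‖ / h`, so `u` dominates all `1 + |y i|` at
    -- once.
    set u := 2 * ‖z - a‖ / h with hu
    have hui : ∀ i, 1 + |y i| ≤ u := by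
      intro i
      rw [hu, le_div_iff₀ hh]
      by_cases hi : i = Fin.last n
      · rw [hi]; linarith
      · have := hle i
        rw [hzother i hi, abs_mul, abs_of_pos hh] at this
        linarith
    have hu1 : 1 ≤ u := by linarith [hui 0, abs_nonneg (y 0)]
    have hu0 : 0 < u := by linarith
    have hgb : |(g z).re| ≤ ‖z - a‖ ^ (-M) := by
      rw [hgre, ← hMb, Real.rpow_add hpos, Real.rpow_natCast, abs_mul,
        abs_of_pos (by positivity : 0 < (‖z - a‖ ^ 2) ^ b), mul_comm, Real.rpow_mul hpos.le,
        Real.rpow_two]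
      gcongr
      refine (Complex.abs_re_le_norm _).trans ?_
      rw [norm_pow]
      gcongr
      exact norm_isotropicForm_le hn _
    have hprod : u ^ (-M) ≤ ∏ i, (1 + |y i|) ^ (-Q) := by
      calc u ^ (-M) ≤ u ^ (-Q * ((n + 1 : ℕ) : ℝ)) := by
            refine Real.rpow_le_rpow_of_exponent_le hu1 ?_
            push_cast
            rw [hM]; nlinarith [(Nat.cast_nonneg n : (0 : ℝ) ≤ n)]
        _ = ∏ _i : Fin (n + 1), u ^ (-Q) := by
            rw [Real.rpow_mul hu0.le, Real.rpow_natCast]; simp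
        _ ≤ _ := by
            refine Finset.prod_le_prod (fun i _ => by positivity) fun i _ => ?_
            exact Real.rpow_le_rpow_of_nonpos (by positivity) (hui i) (by linarith)
    have hzu : ‖z - a‖ ^ (-M) = 2 ^ M * h ^ (-M) * u ^ (-M) := by
      rw [hu, Real.div_rpow (by positivity) hh.le, Real.mul_rpow zero_le_two hpos.le,
        Real.rpow_neg zero_le_two]
      have h2 : (0 : ℝ) < 2 ^ M := by positivity
      have h3 : 0 < h ^ (-M) := by positivity
      field_simp
    rw [hT]
    calc c₁⁻¹ * h ^ M * |(g z).re| ≤ c₁⁻¹ * h ^ M * (2 ^ M * h ^ (-M) * u ^ (-M)) := by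
          rw [← hzu]; gcongr
      _ = 2 ^ M / c₁ * u ^ (-M) := by
          rw [Real.rpow_neg hh.le]
          have : 0 < h ^ M := by positivity
          field_simp
      _ ≤ _ := by gcongr

end TestFunctions

/-! ### An integrable majorant for the rescaled test functions -/

section Majorant

/-- Near `0` the integrand is at most `t ^ α`, integrable as `α > -1`; at infinity it is at most `t
^ (α - P)` with `α - P < -1`. -/
theorem integrable_indicator_rpow_mul {α P : ℝ} (hα : -1 < α) (hP : α + 1 < P) :
    Integrable ((Set.Ioi (0 : ℝ)).indicator fun t => t ^ α * (1 + t) ^ (-P)) := by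
  have hm : Measurable fun t : ℝ => t ^ α * (1 + t) ^ (-P) := by fun_prop
  rw [integrable_indicator_iff measurableSet_Ioi, ← Set.Ioc_union_Ioi_eq_Ioi zero_le_one]
  refine IntegrableOn.union ?_ ?_
  · have h1 : IntegrableOn (fun t : ℝ => t ^ α) (Set.Ioc 0 1) :=
      (intervalIntegrable_iff_integrableOn_Ioc_of_le zero_le_one).1
        (intervalIntegral.intervalIntegrable_rpow' hα)
    refine Integrable.mono' h1 hm.aestronglyMeasurable ?_
    refine (ae_restrict_iff' measurableSet_Ioc).2 (Filter.Eventually.of_forall fun t ht => ?_)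
    have ht0 : 0 < t := ht.1
    rw [Real.norm_of_nonneg (by positivity)]
    refine mul_le_of_le_one_right (by positivity) ?_
    exact Real.rpow_le_one_of_one_le_of_nonpos (by linarith) (by linarith)
  · have h1 : IntegrableOn (fun t : ℝ => t ^ (α - P)) (Set.Ioi 1) :=
      integrableOn_Ioi_rpow_of_lt (by linarith) one_pos
    refine Integrable.mono' h1 hm.aestronglyMeasurable ?_
    refine (ae_restrict_iff' measurableSet_Ioi).2 (Filter.Eventually.of_forall fun t ht => ?_)
    have ht0 : 0 < t := one_pos.trans ht
    rw [Real.norm_of_nonneg (by positivity), sub_eq_add_neg, Real.rpow_add ht0]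
    exact mul_le_mul_of_nonneg_left
      (Real.rpow_le_rpow_of_nonpos ht0 (by linarith) (by linarith)) (by positivity)

/-- The product form reduces integrability to one variable at a time; the indicator in the last
variable discards `t ≤ 0`. -/
theorem exists_integrable_majorant (n : ℕ) {α P : ℝ} (hα : -1 < α) (hP1 : 1 < P)
    (hP : α + 1 < P) :
    ∃ Φ : Amb n → ℝ, Measurable Φ ∧ Integrable Φ ∧
      ∀ y, 0 < height y → (∏ i, (1 + |y i|) ^ (-P)) * height y ^ α ≤ Φ y := by
  let g : Fin (n + 1) → ℝ → ℝ := fun i => if i = Fin.last n then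
    (Set.Ioi (0 : ℝ)).indicator fun t => t ^ α * (1 + t) ^ (-P) else fun x => (1 + ‖x‖) ^ (-P)
  have hgi : ∀ i, Integrable (g i) := by
    intro i
    by_cases hi : i = Fin.last n
    · simp only [g, hi, if_true]
      exact integrable_indicator_rpow_mul hα hP
    · simp only [g, hi, if_false]
      exact integrable_one_add_norm (by simpa using hP1)
  have hgm : ∀ i, Measurable (g i) := by
    intro i
    by_cases hi : i = Fin.last n
    · simp only [g, hi, if_true]
      exact Measurable.indicator (by fun_prop) measurableSet_Ioi
    · simp only [g, hi, if_false]
      fun_prop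
  refine ⟨fun y => ∏ i, g i (y i), ?_, ?_, fun y hy => ?_⟩
  · exact Finset.measurable_prod _ fun i _ =>
      (hgm i).comp (by fun_prop : Continuous fun y : Amb n => y i).measurable
  · exact (PiLp.volume_preserving_ofLp (Fin (n + 1))).integrable_comp_of_integrable
      (Integrable.fintype_prod hgi)
  · simp only [Fin.prod_univ_castSucc]
    have h1 : ∀ i : Fin n, g i.castSucc (y i.castSucc) = (1 + |y i.castSucc|) ^ (-P) := fun i => by
      simp [g, (Fin.castSucc_lt_last i).ne]
    have hy' : 0 < y (Fin.last n) := hy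
    have h2 : g (Fin.last n) (y (Fin.last n)) =
        y (Fin.last n) ^ α * (1 + |y (Fin.last n)|) ^ (-P) := by
      simp [g, hy', abs_of_pos hy']
    rw [h2, Finset.prod_congr rfl fun i _ => h1 i]
    unfold height
    exact le_of_eq (by ring)

end Majorant

/-! ### Testing on single cubes; necessity of the measure condition -/

namespace WhitneyDecomposition

variable {n : ℕ} (W : WhitneyDecomposition n)

theorem exists_tsum_setLIntegral_enlargedCube_le : ∃ C : ℝ≥0, ∀ G : Amb n → ℝ≥0∞, Measurable G →
    ∑' j, ∫⁻ z in W.enlargedCube j, G z ≤ C * ∫⁻ z, G z := by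
  obtain ⟨C, hC⟩ := W.finite_overlap
  refine ⟨C, fun G hG => ?_⟩
  have hms : ∀ j, MeasurableSet (W.enlargedCube j) := fun j =>
    (isClosed_closedCube _ _).measurableSet
  calc ∑' j, ∫⁻ z in W.enlargedCube j, G z
      = ∑' j, ∫⁻ z, (W.enlargedCube j).indicator G z :=
        tsum_congr fun j => (lintegral_indicator (hms j) _).symm
    _ = ∫⁻ z, ∑' j, (W.enlargedCube j).indicator G z :=
        (lintegral_tsum fun j => (hG.indicator (hms j)).aemeasurable).symm
    _ ≤ ∫⁻ z, C * G z := by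
        refine lintegral_mono fun z => ?_
        have h1 : ∀ j, (W.enlargedCube j).indicator G z =
            (W.enlargedCube j).indicator (1 : Amb n → ℝ≥0∞) z * G z := fun j => by
          by_cases hz : z ∈ W.enlargedCube j <;> simp [hz]
        simp only [h1, ENNReal.tsum_mul_right]
        exact mul_le_mul_left (hC z) _
    _ = C * ∫⁻ z, G z := lintegral_const_mul _ hG

/-- For each Whitney cube there is a harmonic function which is at least `1` on the cube and whose
weighted `Lᵖ` norm is of the order of the weighted measure of the cube. -/
theorem exists_harmonic_test (𝕜 : Type*) [RCLike 𝕜] (hn : 1 ≤ n) {p α : ℝ} (hp : 0 < p)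
    (hα : -1 < α) :
    ∃ C : ℝ≥0, ∀ k, ∃ f : Amb n → 𝕜, HarmonicOnNhd f (upperHalf n) ∧
      (∀ z ∈ W.cube k, 1 ≤ ‖f z‖ₑ) ∧
      ∑' j, ∫⁻ z in W.enlargedCube j, ‖f z‖ₑ ^ p * ENNReal.ofReal (height z ^ α) ≤
        C * ENNReal.ofReal (W.side k ^ ((n : ℝ) + 1 + α)) := by
  obtain ⟨K, hK, hKs⟩ := W.exists_height_center_le
  -- This exceeds both `1` and `α + 1`; decay `P / p` for `f` becomes decay `P` for `|f|^p`.
  set P : ℝ := |α| + 2 with hP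
  have hP1 : 1 < P := by rw [hP]; linarith [abs_nonneg α]
  have hPα : α + 1 < P := by rw [hP]; linarith [le_abs_self α]
  obtain ⟨A, hA, hf⟩ := exists_harmonic_decay 𝕜 hn hK (div_pos (by linarith : 0 < P) hp)
  obtain ⟨Φ, hΦm, hΦi, hΦ⟩ := exists_integrable_majorant n hα hP1 hPα
  obtain ⟨D, hD⟩ := W.exists_tsum_setLIntegral_enlargedCube_le
  set J := ∫⁻ y, ENNReal.ofReal (Φ y) with hJ
  have hJt : J ≠ ∞ := (hΦi.lintegral_lt_top).ne
  refine ⟨D * ((A ^ p).toNNReal * J.toNNReal), fun k => ?_⟩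
  set h := W.side k with hh
  have hpos : 0 < h := W.side_pos k
  set c := W.center k with hc
  have hc0 : 0 < height c := by linarith [W.lt_height_center k]
  -- The foot of the centre on the boundary: with `z = x + h y`, heights scale exactly by `h`.
  set x := c - EuclideanSpace.single (Fin.last n) (height c) with hx
  have hx0 : x (Fin.last n) = 0 := by simp [hx, height]
  obtain ⟨f, hf1, hf2, hf3⟩ := hf c h hpos hc0 (hKs k)
  refine ⟨f, hf1, fun z hz => ?_, ?_⟩
  · have hz0 : z ∈ upperHalf n := W.iUnion_cube ▸ Set.mem_iUnion_of_mem k hz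
    rw [← ofReal_norm, ← ENNReal.ofReal_one]
    exact ENNReal.ofReal_le_ofReal (hf2 z hz hz0)
  set G : Amb n → ℝ≥0∞ := fun z => ENNReal.ofReal (Φ (h⁻¹ • (z - x))) with hG
  have hGm : Measurable G :=
    (hΦm.comp (by fun_prop : Continuous fun z : Amb n => h⁻¹ • (z - x)).measurable).ennreal_ofReal
  have hGint : ∫⁻ z, G z = ENNReal.ofReal (h ^ (n + 1)) * J := by
    have h1 := ofReal_pow_mul_lintegral_comp_add_smul volume G x hpos
    rw [show Module.finrank ℝ (Amb n) = n + 1 from finrank_euclideanSpace_fin] at h1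
    rw [← h1, hJ]
    simp [hG, smul_smul, inv_mul_cancel₀ hpos.ne']
  have hpt : ∀ z ∈ upperHalf n, ‖f z‖ₑ ^ p * ENNReal.ofReal (height z ^ α) ≤
      ENNReal.ofReal (A ^ p * h ^ α) * G z := by
    intro z hz
    have hz0 : 0 < height z := hz
    set y := h⁻¹ • (z - x) with hy
    have hzy : z = x + h • y := by
      rw [hy, smul_smul, mul_inv_cancel₀ hpos.ne', one_smul, add_sub_cancel]
    have hhz : height z = h * height y := by
      rw [hzy]; simp [height, hx0]
    have hy0 : 0 < height y := by
      rw [hhz] at hz0; exact pos_of_mul_pos_right hz0 hpos.le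
    have hb := hf3 y hy0
    rw [← hzy] at hb
    rw [← ofReal_norm, ENNReal.ofReal_rpow_of_nonneg (norm_nonneg _) hp.le,
      ← ENNReal.ofReal_mul (by positivity), hG, ← ENNReal.ofReal_mul (by positivity)]
    refine ENNReal.ofReal_le_ofReal ?_
    calc ‖f z‖ ^ p * height z ^ α
        ≤ (A * ∏ i, (1 + |y i|) ^ (-(P / p))) ^ p * height z ^ α := by gcongr
      _ = A ^ p * h ^ α * ((∏ i, (1 + |y i|) ^ (-P)) * height y ^ α) := by
        rw [Real.mul_rpow hA.le (by positivity),
          ← Real.finsetProd_rpow _ _ (fun i _ => by positivity), hhz, Real.mul_rpow hpos.le hy0.le]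
        simp_rw [fun i => (Real.rpow_mul (by positivity : 0 ≤ 1 + |y i|) (-(P / p)) p).symm,
          neg_mul, div_mul_cancel₀ P hp.ne']
        ring
      _ ≤ _ := by
        gcongr
        exact hΦ y hy0
  calc ∑' j, ∫⁻ z in W.enlargedCube j, ‖f z‖ₑ ^ p * ENNReal.ofReal (height z ^ α)
      ≤ ∑' j, ∫⁻ z in W.enlargedCube j, ENNReal.ofReal (A ^ p * h ^ α) * G z :=
        ENNReal.tsum_le_tsum fun j => setLIntegral_mono' (isClosed_closedCube _ _).measurableSet
          fun z hz => hpt z (W.enlarged_subset j hz)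
    _ ≤ D * ∫⁻ z, ENNReal.ofReal (A ^ p * h ^ α) * G z := hD _ (hGm.const_mul _)
    _ = D * (ENNReal.ofReal (A ^ p * h ^ α) * (ENNReal.ofReal (h ^ (n + 1)) * J)) := by
        rw [lintegral_const_mul _ hGm, hGint]
    _ = _ := by
        rw [Real.rpow_add hpos, show (n : ℝ) + 1 = ((n + 1 : ℕ) : ℝ) by push_cast; rfl,
          Real.rpow_natCast, ENNReal.ofReal_mul (by positivity), ENNReal.ofReal_mul (by positivity),
          ENNReal.coe_mul, ENNReal.coe_mul, ENNReal.coe_toNNReal hJt, ← ENNReal.ofReal]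
        ring

/-- With `S` the sum, `a k ≤ S` gives `a k ^ q ≤ a k * S ^ (q - 1)`. -/
theorem _root_.tsum_rpow_rpow_one_div_le_tsum (a : ℕ → ℝ≥0∞) {q : ℝ} (hq : 1 ≤ q) :
    (∑' k, a k ^ q) ^ (1 / q) ≤ ∑' k, a k := by
  have hq0 : 0 < q := by linarith
  rw [one_div, ENNReal.rpow_inv_le_iff hq0]
  have hsplit : ∀ x : ℝ≥0∞, x ^ q = x * x ^ (q - 1) := fun x => by
    nth_rewrite 2 [← ENNReal.rpow_one x]
    rw [← ENNReal.rpow_add_of_nonneg _ _ zero_le_one (by linarith), add_sub_cancel]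
  calc ∑' k, a k ^ q ≤ ∑' k, a k * (∑' k, a k) ^ (q - 1) := by
        refine ENNReal.tsum_le_tsum fun k => ?_
        rw [hsplit]
        gcongr
        exact ENNReal.le_tsum k
    _ = _ := by rw [ENNReal.tsum_mul_right, ← hsplit]

theorem measure_cube_le_of_lintegral_prod_le {𝕜 : Type*} [RCLike 𝕜] (hn : 1 ≤ n) {m : ℕ}
    (μ : Measure (Amb n)) {p q : Fin m → ℝ} (hp : ∀ i, 0 < p i) (hq : ∀ i, 0 < q i)
    (hsum : ∑ i, 1 / q i = 1) {α : ℝ} (hα : -1 < α)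
    (h : ∃ C : ℝ≥0, ∀ f : Fin m → Amb n → 𝕜, (∀ i, HarmonicOnNhd (f i) (upperHalf n)) →
      ∫⁻ z in upperHalf n, ∏ i, ‖f i z‖ₑ ^ p i ∂μ ≤
        C * ∏ i, (∑' k, (∫⁻ z in W.enlargedCube k,
          ‖f i z‖ₑ ^ p i * ENNReal.ofReal (height z ^ α)) ^ q i) ^ (1 / q i)) :
    ∃ C : ℝ≥0, ∀ k,
      μ (W.cube k) ≤ C * volume (W.cube k) ^ ((m : ℝ) * (1 + α / ((n : ℝ) + 1))) := by
  obtain ⟨C, hC⟩ := h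
  choose D hD using fun i => W.exists_harmonic_test 𝕜 hn (hp i) hα
  -- Each `1 / q i` is at most the full sum, which is `1`.
  have hq1 : ∀ i, 1 ≤ q i := fun i => by
    have h1 : 1 / q i ≤ ∑ j, 1 / q j := Finset.single_le_sum (f := fun i => 1 / q i)
      (fun j _ => (one_div_pos.2 (hq j)).le) (Finset.mem_univ i)
    rw [hsum] at h1
    rwa [div_le_one (hq i)] at h1
  refine ⟨C * ∏ i, D i, fun k => ?_⟩
  choose f hf1 hf2 hf3 using fun i => hD i k
  rw [W.volume_cube_rpow]
  calc μ (W.cube k) = ∫⁻ _ in W.cube k, 1 ∂μ := by simp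
    _ ≤ ∫⁻ z in W.cube k, ∏ i, ‖f i z‖ₑ ^ p i ∂μ :=
        setLIntegral_mono' (isClosed_closedCube _ _).measurableSet fun z hz =>
          Finset.one_le_prod' fun i _ => ENNReal.one_le_rpow (hf2 i z hz) (hp i)
    _ ≤ ∫⁻ z in upperHalf n, ∏ i, ‖f i z‖ₑ ^ p i ∂μ :=
        lintegral_mono_set (W.iUnion_cube ▸ Set.subset_iUnion W.cube k)
    _ ≤ _ := hC f hf1
    _ ≤ C * ∏ i, (D i * ENNReal.ofReal (W.side k ^ ((n : ℝ) + 1 + α))) := by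
        gcongr with i _
        exact (tsum_rpow_rpow_one_div_le_tsum _ (hq1 i)).trans (hf3 i)
    _ = _ := by
        rw [Finset.prod_mul_distrib, Finset.prod_const, Finset.card_univ, Fintype.card_fin]
        push_cast
        ring

end WhitneyDecomposition

theorem theorem1 {𝕜 : Type*} [RCLike 𝕜] {n m : ℕ} (hn : 1 ≤ n)
    (W : WhitneyDecomposition n) (μ : Measure (Amb n))
    (p q : Fin m → ℝ) (hp : ∀ i, 0 < p i) (hq : ∀ i, 0 < q i) (hsum : ∑ i, 1 / q i = 1)
    (α : ℝ) (hα : -1 < α) :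
    (∃ C : ℝ≥0, ∀ f : Fin m → Amb n → 𝕜, (∀ i, HarmonicOnNhd (f i) (upperHalf n)) →
      ∫⁻ z in upperHalf n, ∏ i, ‖f i z‖ₑ ^ p i ∂μ ≤
        C * ∏ i, (∑' k, (∫⁻ z in W.enlargedCube k,
          ‖f i z‖ₑ ^ p i * ENNReal.ofReal (height z ^ α)) ^ q i) ^ (1 / q i)) ↔
    (∃ C : ℝ≥0, ∀ k,
      μ (W.cube k) ≤ C * volume (W.cube k) ^ ((m : ℝ) * (1 + α / ((n : ℝ) + 1)))) :=
  ⟨W.measure_cube_le_of_lintegral_prod_le hn μ hp hq hsum hα,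
    W.lintegral_prod_le_of_measure_cube_le μ hp hq hsum α⟩
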